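/- **Setting.** Let $\mathcal S=\{1,\dots,d\}$, let $U\subset\mathbb R^\ell$ ($\ell\ge 1$) be compact with positive Lebesgue measure, and for each $u\in U$ let $q^u$ be a $d\times d$ rate matrix. Let $f:[0,\infty)\times\mathcal S\times U\to\mathbb R$, and let $\delta:[0,\infty)\to[0,1]$ be nonincreasing with $\delta(0)=1$. A relaxed control is a map $\pi:\mathcal S\to\mathcal P(U)$ (Borel probability measures); $\Pi$ is the set of all of them, and $\Pi_r$ the set of those for which every $\pi(i)$ has a Lebesgue density on $U$ with differential entropy $\mathcal H(\rho)=-\int_U\rho\ln\rho\,du>-\infty$. For $\pi\in\Pi$ write $f^{\pi(i)}(t,i)=\int_U f(t,i,u)\,\pi(i)(du)$. *Continuous time.* Under $\pi$ the state $X$ is the continuous-time Markov chain with generator $Q^\pi_{ij}=\int_U q^u_{ij}\,\pi(i)(du)$. For $\lambda>0$ put $$\widetilde J^\pi(i)=\mathbb E_i\Big[\int_0^\infty f^{\pi(X_s)}(s,X_s)\,ds\Big],\qquad \widetilde J_\lambda^\pi(i)=\mathbb E_i\Big[\int_0^\infty\big(f^{\pi(X_s)}(s,X_s)+\lambda\delta(s)\mathcal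 H(\pi(X_s))\big)ds\Big].$$ Let $\pi'\otimes_\varepsilon\pi$ mean that $\pi'$ is used on $[0,\varepsilon)$ and $\pi$ on $[\varepsilon,\infty)$. A control $\pi\in\Pi$ is a relaxed equilibrium for $\widetilde J$ if $\limsup_{\varepsilon\downarrow0}\varepsilon^{-1}\big(\widetilde J^{\pi'\otimes_\varepsilon\pi}(i)-\widetilde J^\pi(i)\big)\le 0$ for all $i\in\mathcal S$ and $\pi'\in\Pi$. A control $\pi\in\Pi_r$ is a relaxed equilibrium for $\widetilde J_\lambda$ if the same holds with $\widetilde J_\lambda$ in place of $\widetilde J$, for all $\pi'\in\Pi_r$. *Discretization with step $h$.* Let $(p_h)^u=hq^u+I$ and $f_h(k,i,u)=h f(kh,i,u)$, $k\in\mathbb N_0$. Under $\pi$ let $X^h$ be the discrete-time Markov chain with transition matrix $\big(\int_U (p_h)^u_{ij}\,\pi(i)(du)\big)_{ij}$, and put $$J^{h,\pi}(i)=\mathbb E_i\Big[\sum_{k\ge0}f_h^{\pi(X^h_k)}(k,X^h_k)\Big],\qquad J_\lambda^{h,\pi}(i)=\mathbb E_i\Big[\sum_{k\ge0}\big(f_h^{\pi(X^h_k)}(k,X^h_k)+h\lambda\,\delta(kh)\,\mathcal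 H(\pi(X^h_k))\big)\Big].$$ Let $\pi'\otimes_1\pi$ mean that $\pi'$ is used at time $0$ and $\pi$ afterwards. A control $\pi\in\Pi$ (resp. $\pi\in\Pi_r$) is a relaxed equilibrium for $J^{h}$ (resp. $J^h_\lambda$) if $J^{h,\pi'\otimes_1\pi}(i)\le J^{h,\pi}(i)$ (resp. $J_\lambda^{h,\pi'\otimes_1\pi}(i)\le J_\lambda^{h,\pi}(i)$) for all $i\in\mathcal S$ and all $\pi'\in\Pi$ (resp. $\pi'\in\Pi_r$). **Assumptions.** 1. $\int_0^\infty\big(\sup_{i,u}|f(s,i,u)|+\delta(s)\big)ds<\infty$. 2. $u\mapsto f(t,i,u)$ and $u\mapsto q^u_i$ are Lipschitz on $U$, uniformly in $(t,i)\in[0,\infty)\times\mathcal S$. 3. (Uniform cone condition.) There are $\vartheta>0$ and $\iota\in(0,\pi/2]$ such that for every $u\in U$ there is a unit vector $e$ with $\{v:\ \langle e,v-u\rangle\ge\cos(\iota)|v-u|\}\cap B_\vartheta(u)\subseteq U$. 4. $f(\cdot,i,u)$ and $\delta$ are continuous on $[0,\infty)$. 5. $h_n\in(0,1]$, $h_n\to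 0$, and the steps are small enough that every $(p_{h_n})^u$ is a transition matrix, i.e. $1+h_nq^u_{ii}\ge0$ for all $n,i,u$. 6. The discretized rewards are summable with tails vanishing uniformly in $n$: $\displaystyle\lim_{T\to\infty}\sup_n\ h_n\!\!\sum_{k:\,kh_n\ge T}\ \sup_{i,u}|f(kh_n,i,u)|=0$. **Theorem.** (a) Fix $\lambda>0$ and for every $n$ let $\pi^n\in\Pi_r$ be a relaxed equilibrium for $J^{h_n}_\lambda$. Then every $\pi^n(i)$ has a density continuous on $U$, and there are a subsequence and $\pi^\infty\in\Pi_r$, also with densities continuous on $U$, such that for every $i\in\mathcal S$ these densities of $\pi^{n}(i)$ converge, along the subsequence, to that of $\pi^\infty(i)$ at every point of $U$; moreover $\pi^\infty$ is a relaxed equilibrium for $\widetilde J_\lambda$. (b) For every $n$ let $\pi^n\in\Pi$ be a relaxed equilibrium for $J^{h_n}$. Then there are a subsequence and $\pi^\infty\in\Pi$ such that $\pi^n(i)\to\pi^\infty(i)$ weakly along the subsequence for every $i\in\mathcal S$; moreover $\pi^\infty$ is a relaxed equilibrium for $\widetilde J$. -/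

import Mathlib

open MeasureTheory Filter Set Topology
open scoped ENNReal

noncomputable section

namespace RelaxedMDP

/-- A relaxed feedback control: to each state `i ∈ {1, …, d}` it assigns a Borel probability measure
on the action space `U ⊆ ℝ^ℓ` (`ProbabilityMeasure U` carries the topology of weak convergence). -/
abbrev Control (d : ℕ) {ℓ : ℕ} (U : Set (EuclideanSpace ℝ (Fin ℓ))) : Type :=
  Fin d → ProbabilityMeasure U

variable {d ℓ : ℕ} {U : Set (EuclideanSpace ℝ (Fin ℓ))}

/-! ### Regular controls and entropy -/

/-- Lebesgue measure on the action space `U`. -/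
def leb (U : Set (EuclideanSpace ℝ (Fin ℓ))) : Measure U := Measure.comap Subtype.val volume

/-- `ρ` is a (version of the) density of `μ` with respect to Lebesgue measure on `U`. -/
def IsDensityOf (μ : ProbabilityMeasure U) (ρ : U → ℝ) : Prop :=
  Measurable ρ ∧ (∀ u, 0 ≤ ρ u) ∧
    (μ : Measure U) = (leb U).withDensity (fun u => ENNReal.ofReal (ρ u))

/-- Shannon differential entropy `- ∫_U ln (ρ u) ρ u du`. -/
def densityEntropy (ρ : U → ℝ) : ℝ := - ∫ u, Real.log (ρ u) * ρ u ∂(leb U)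

/-- Shannon differential entropy of the Lebesgue density of `μ`. -/
def entropy (μ : ProbabilityMeasure U) : ℝ :=
  densityEntropy (fun u => ((μ : Measure U).rnDeriv (leb U) u).toReal)

/-- Regular controls: every `π i` has a density whose entropy is `> -∞`. Since `r ln r ≥ -1/e` and `U`
has finite Lebesgue measure, the entropy is well defined in `[-∞, ∞)`, and it is `> -∞` exactly when
`ρ ln ρ` is integrable. -/
def IsRegular (π : Control d U) : Prop :=
  ∀ i, ∃ ρ : U → ℝ, IsDensityOf (π i) ρ ∧ Integrable (fun u => Real.log (ρ u) * ρ u) (leb U)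

/-! ### Rewards and averaged transition matrices -/

/-- `f^{π(i)}(t, i) = ∫_U f(t, i, u) (π(i))(du)`; the time set `𝕋` is `ℕ` or `ℝ`. -/
def avgReward {𝕋 : Type} (f : 𝕋 → Fin d → U → ℝ) (t : 𝕋) (π : Control d U) (i : Fin d) : ℝ :=
  ∫ u, f t i u ∂(π i : Measure U)

/-- `f^{π(i)}(t, i) + lam * δ(t) * H(π(i))`. -/
def avgRewardEnt {𝕋 : Type} (f : 𝕋 → Fin d → U → ℝ) (δ : 𝕋 → ℝ) (lam : ℝ)
    (t : 𝕋) (π : Control d U) (i : Fin d) : ℝ :=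
  avgReward f t π i + lam * δ t * entropy (π i)

/-- The matrix with entries `∫_U m^u_{ij} (π(i))(du)`: the transition matrix induced by `π` if `m^u`
are transition matrices, the relaxed rate matrix if `m^u` are rate matrices. -/
def avgMatrix (m : U → Matrix (Fin d) (Fin d) ℝ) (π : Control d U) : Matrix (Fin d) (Fin d) ℝ :=
  Matrix.of fun i j => ∫ u, m u i j ∂(π i : Measure U)

/-! ### Discrete time -/

/-- The law of `X_k` (as a row vector) for the discrete-time chain started at `i` and controlled by
`σ 0, σ 1, …`: the distribution is propagated from time `k` to `k + 1` by the transition matrix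
induced by `σ k`. -/
def discLaw (p : U → Matrix (Fin d) (Fin d) ℝ) (σ : ℕ → Control d U) (i : Fin d) :
    ℕ → Fin d → ℝ
  | 0 => Pi.single i 1
  | k + 1 => Matrix.vecMul (discLaw p σ i k) (avgMatrix p (σ k))

/-- `E_i [ ∑_k r(k, σ_k, X_k) ]`, where `r k π j` is the reward collected at time `k` in state `j`
under the control `π`. -/
def discValue (p : U → Matrix (Fin d) (Fin d) ℝ) (r : ℕ → Control d U → Fin d → ℝ)
    (σ : ℕ → Control d U) (i : Fin d) : ℝ :=
  ∑' k : ℕ, ∑ j, discLaw p σ i k j * r k (σ k) j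

/-- The concatenation `π' ⊗₁ π`: use `π'` at time `0` and `π` from time `1` onward. -/
def concatOne (π' π : Control d U) : ℕ → Control d U
  | 0 => π'
  | _ + 1 => π

/-- `π` is an equilibrium in discrete time, within the class `A` of admissible controls. -/
def IsDiscEquilibrium (A : Set (Control d U)) (p : U → Matrix (Fin d) (Fin d) ℝ)
    (r : ℕ → Control d U → Fin d → ℝ) (π : Control d U) : Prop :=
  π ∈ A ∧ ∀ i, ∀ π' ∈ A,
    discValue p r (concatOne π' π) i - discValue p r (fun _ => π) i ≤ 0

/-! ### Continuous time -/

/-- A rate matrix (generator). -/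
def IsRateMatrix (Q : Matrix (Fin d) (Fin d) ℝ) : Prop :=
  (∀ i j, j ≠ i → 0 ≤ Q i j) ∧ ∀ i, Q i i = - ∑ j ∈ Finset.univ.erase i, Q i j

/-- Transition probabilities `P_i(X_s = j)` of the continuous-time chain with generator `Q^π`. -/
def contTrans (q : U → Matrix (Fin d) (Fin d) ℝ) (π : Control d U) (s : ℝ) :
    Matrix (Fin d) (Fin d) ℝ :=
  NormedSpace.exp (s • avgMatrix q π)

/-- `E_i [ ∫_0^∞ r(s, π, X_s) ds ]` for the chain controlled by `π`. -/
def contValue (q : U → Matrix (Fin d) (Fin d) ℝ) (r : ℝ → Control d U → Fin d → ℝ)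
    (π : Control d U) (i : Fin d) : ℝ :=
  ∫ s in Ioi (0 : ℝ), ∑ j, contTrans q π s i j * r s π j

/-- The control in force at time `s` under `π' ⊗_ε π`. -/
def concatAt (ε : ℝ) (π' π : Control d U) (s : ℝ) : Control d U :=
  if s < ε then π' else π

/-- Transition probabilities `P_i(X_s = j)` under `π' ⊗_ε π`: the chain is governed by `π'` on
`[0, ε)` and by `π` on `[ε, ∞)`. -/
def concatTrans (q : U → Matrix (Fin d) (Fin d) ℝ) (ε : ℝ) (π' π : Control d U) (s : ℝ) :
    Matrix (Fin d) (Fin d) ℝ :=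
  if s < ε then contTrans q π' s else contTrans q π' ε * contTrans q π (s - ε)

/-- The value of `π' ⊗_ε π`. -/
def contValueConcat (q : U → Matrix (Fin d) (Fin d) ℝ) (r : ℝ → Control d U → Fin d → ℝ)
    (ε : ℝ) (π' π : Control d U) (i : Fin d) : ℝ :=
  ∫ s in Ioi (0 : ℝ), ∑ j, concatTrans q ε π' π s i j * r s (concatAt ε π' π s) j

/-- `π` is an equilibrium in continuous time, within the class `A` of admissible controls. -/
def IsContEquilibrium (A : Set (Control d U)) (q : U → Matrix (Fin d) (Fin d) ℝ)
    (r : ℝ → Control d U → Fin d → ℝ) (π : Control d U) : Prop :=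
  π ∈ A ∧ ∀ π' ∈ A, ∀ i,
    limsup (fun ε : ℝ =>
      (((contValueConcat q r ε π' π i - contValue q r π i) / ε : ℝ) : EReal)) (𝓝[>] 0) ≤ 0

/-! ### The discretization with step `h` -/

/-- `(p_h)^u = h q^u + I`. -/
def stepMatrix (h : ℝ) (q : U → Matrix (Fin d) (Fin d) ℝ) (u : U) : Matrix (Fin d) (Fin d) ℝ :=
  h • q u + 1

/-- `f_h(k, i, u) = f(kh, i, u) h`. -/
def stepReward (h : ℝ) (f : ℝ → Fin d → U → ℝ) (k : ℕ) (i : Fin d) (u : U) : ℝ :=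
  f (k * h) i u * h

/-- The discount function sampled at the grid times `kh`. -/
def stepDiscount (h : ℝ) (δ : ℝ → ℝ) (k : ℕ) : ℝ := δ (k * h)

/-! ### Assumptions -/

/-- A discount function `δ : [0, ∞) → [0, 1]`, nonincreasing with `δ(0) = 1`. -/
def IsDiscount (δ : ℝ → ℝ) : Prop :=
  (∀ t, 0 ≤ t → δ t ∈ Icc (0 : ℝ) 1) ∧ AntitoneOn δ (Ici 0) ∧ δ 0 = 1

/-- `sup_{i, u} |f(t, i, u)|`, as an extended nonnegative real. -/
def supReward (f : ℝ → Fin d → U → ℝ) (t : ℝ) : ℝ≥0∞ := ⨆ i, ⨆ u, ‖f t i u‖ₑ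

/-- `∫_0^∞ (sup_{i, u} |f(s, i, u)| + δ(s)) ds < ∞`. -/
def IntegrableReward (f : ℝ → Fin d → U → ℝ) (δ : ℝ → ℝ) : Prop :=
  ∫⁻ s in Ici (0 : ℝ), (supReward f s + ‖δ s‖ₑ) < ⊤

/-- `u ↦ f(t, i, u)` and `u ↦ q^u_i` are Lipschitz, uniformly in `(t, i)`. -/
def UniformLipschitz (f : ℝ → Fin d → U → ℝ) (q : U → Matrix (Fin d) (Fin d) ℝ) : Prop :=
  ∃ Θ : ℝ, ∀ t, 0 ≤ t → ∀ i, ∀ u₁ u₂ : U,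
    |f t i u₁ - f t i u₂| + ‖q u₁ i - q u₂ i‖ ≤ Θ * dist u₁ u₂

/-- The closed (one-sided) circular cone with vertex `u`, unit axis `e` and angle `ι`, that is, all
`v` such that `v - u` makes an angle at most `ι` with `e`. For `e` the last basis vector and `u = 0`
this is `u_1² + … + u_{ℓ-1}² ≤ tan(ι)² u_ℓ²`, `u_ℓ ≥ 0`; the other axes give its rotations. -/
def circularCone (u e : EuclideanSpace ℝ (Fin ℓ)) (ι : ℝ) : Set (EuclideanSpace ℝ (Fin ℓ)) :=
  {v | Real.cos ι * ‖v - u‖ ≤ inner ℝ e (v - u)}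

/-- Uniform cone condition. For `ℓ = 1` the cones are the half-lines issuing from `u`. -/
def UniformCone (U : Set (EuclideanSpace ℝ (Fin ℓ))) : Prop :=
  ∃ ϑ > 0, ∃ ι ∈ Ioc 0 (Real.pi / 2), ∀ u ∈ U, ∃ e : EuclideanSpace ℝ (Fin ℓ),
    ‖e‖ = 1 ∧ circularCone u e ι ∩ Metric.ball u ϑ ⊆ U

/-- The discretized rewards are summable, with tails `∑_{k : k h_n ≥ T} sup_{i, u} |f_{h_n}(k, i, u)|`
that vanish as `T → ∞` uniformly in `n`. -/
def UniformTails (f : ℝ → Fin d → U → ℝ) (h : ℕ → ℝ) : Prop :=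
  ∀ ε : ℝ, 0 < ε → ∃ T : ℝ, ∀ n,
    (∑' k : ℕ, if T ≤ k * h n then ENNReal.ofReal (h n) * supReward f (k * h n) else 0)
      ≤ ENNReal.ofReal ε

end RelaxedMDP

end

/-! In both settings, being an equilibrium comes down to a static condition: for each state `i`, the
measure `π(i)` maximizes the Hamiltonian `r(0, π', i) + ∑ j, Q^π'_ij V_j`, where `V` is the
continuation value of `π` itself. In discrete time this follows by splitting off the first step and
cancelling the identity part of `h Q + 1` (`IsDiscEquilibrium.le`). In continuous time the
derivative at `ε = 0` of the value of `π' ⊗_ε π` is the difference of the two Hamiltonians, so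
maximality suffices (`isContEquilibrium_of_forall_le`). It remains to pass to the limit in the
static inequality.

The values converge (`tendsto_gridValue`) because the discrete value is the integral of a step
function. Its integrand converges pointwise by the Euler approximation `(h Q + 1)^⌊s/h⌋ → exp(s Q)`,
and it is bounded on bounded intervals with uniformly small tails.

Without entropy, weak compactness of the controls supplies the limit. With entropy this is not
enough, since entropy is not weakly continuous. By Gibbs' variational principle, however, each
equilibrium consists of Gibbs measures with potential `(f(0,i,·) + ∑ j, q_ij V_j) / λ`, so it is
determined by the vector `V`. Hence it suffices to bound `V`. The value grows at most linearly in
the size of the entropies. The cone condition bounds the entropy of a Gibbs measure from below by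
minus a constant minus `ℓ log (1 + L)`, with `L` the Lipschitz constant of the potential, which is
at most affine in `‖V‖`. So `‖V‖` is at most affine in its own logarithm, hence bounded. Along a
convergent subsequence of `V` the Gibbs densities and their entropies converge, and the limit of `V`
is the value of the limiting control. -/

noncomputable section

namespace RelaxedMDP

/-! ### Euler approximation of the matrix exponential -/

section MatrixExp

open scoped Matrix.Norms.Operator

variable {d : ℕ}

/-- Stability: each step contributes an error of order `‖A - B‖`, which the contraction `A` does not
amplify. Of `B`, the exact flow in the application, only bounded powers are needed. -/
theorem norm_pow_sub_pow_le {A B : Matrix (Fin d) (Fin d) ℝ} {C : ℝ} (hA : ‖A‖ ≤ 1)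
    {k : ℕ} (hB : ∀ i ≤ k, ‖B ^ i‖ ≤ C) : ‖A ^ k - B ^ k‖ ≤ k * (C * ‖A - B‖) := by
  induction k with
  | zero => simp
  | succ k ih =>
    have h1 := ih fun i hi => hB i (hi.trans k.le_succ)
    have h2 : A ^ (k + 1) - B ^ (k + 1) = A * (A ^ k - B ^ k) + (A - B) * B ^ k := by
      rw [pow_succ', pow_succ']; noncomm_ring
    calc ‖A ^ (k + 1) - B ^ (k + 1)‖ ≤ ‖A‖ * ‖A ^ k - B ^ k‖ + ‖A - B‖ * ‖B ^ k‖ := by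
          rw [h2]
          exact (norm_add_le _ _).trans (add_le_add (norm_mul_le _ _) (norm_mul_le _ _))
      _ ≤ 1 * (k * (C * ‖A - B‖)) + ‖A - B‖ * C := by
          gcongr
          exact hB k k.le_succ
      _ = _ := by push_cast; ring

theorem exists_norm_exp_le (R : ℝ) :
    ∃ C, ∀ A : Matrix (Fin d) (Fin d) ℝ, ‖A‖ ≤ R → ‖NormedSpace.exp A‖ ≤ C := by
  have : ProperSpace (Matrix (Fin d) (Fin d) ℝ) := FiniteDimensional.proper ℝ _
  obtain ⟨C, hC⟩ := (isCompact_closedBall (0 : Matrix (Fin d) (Fin d) ℝ) R).exists_bound_of_continuousOn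
    (f := fun A => NormedSpace.exp A) NormedSpace.exp_continuous.continuousOn
  exact ⟨C, fun A hA => hC A (by simpa using hA)⟩

/-- Consistency plus stability: one Euler step misses `exp (h Q)` by `o(h)`, because the derivative
of `exp` at `0` is the identity, and about `s / h` such errors add up to `o(1)`. -/
theorem tendsto_one_add_smul_pow_exp {Q : ℕ → Matrix (Fin d) (Fin d) ℝ}
    {Q₀ : Matrix (Fin d) (Fin d) ℝ} {h : ℕ → ℝ} {k : ℕ → ℕ} {s : ℝ}
    (hh : ∀ n, 0 < h n) (hh0 : Tendsto h atTop (𝓝 0)) (hQ : Tendsto Q atTop (𝓝 Q₀))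
    (hnorm : ∀ n, ‖1 + h n • Q n‖ ≤ 1) (hk : Tendsto (fun n => k n * h n) atTop (𝓝 s)) :
    Tendsto (fun n => (1 + h n • Q n) ^ k n) atTop (𝓝 (NormedSpace.exp (s • Q₀))) := by
  have hexp : Tendsto (fun n => NormedSpace.exp (h n • Q n) ^ k n) atTop
      (𝓝 (NormedSpace.exp (s • Q₀))) := by
    have h1 : (fun n => NormedSpace.exp (h n • Q n) ^ k n)
        = fun n => NormedSpace.exp ((k n * h n) • Q n) := by
      funext n
      rw [← Matrix.exp_nsmul, ← Nat.cast_smul_eq_nsmul ℝ, smul_smul]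
    rw [h1]
    exact (NormedSpace.exp_continuous.tendsto _).comp (hk.smul hQ)
  obtain ⟨M, hM⟩ : ∃ M, ∀ n, ‖Q n‖ ≤ M := by
    obtain ⟨M, hM⟩ := (Metric.isBounded_range_of_tendsto _ hQ).exists_norm_le
    exact ⟨M, fun n => hM _ (mem_range_self n)⟩
  obtain ⟨S, hS⟩ : ∃ S, ∀ n, ‖(k n * h n : ℝ)‖ ≤ S := by
    obtain ⟨M, hM⟩ := (Metric.isBounded_range_of_tendsto _ hk).exists_norm_le
    exact ⟨M, fun n => hM _ (mem_range_self n)⟩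
  obtain ⟨C, hC⟩ := exists_norm_exp_le (d := d) (S * M)
  have hB : ∀ n, ∀ i ≤ k n, ‖NormedSpace.exp (h n • Q n) ^ i‖ ≤ C := by
    intro n i hi
    rw [← Matrix.exp_nsmul, ← Nat.cast_smul_eq_nsmul ℝ, smul_smul]
    apply hC
    rw [norm_smul]
    have : ‖(i * h n : ℝ)‖ ≤ ‖(k n * h n : ℝ)‖ := by
      rw [norm_mul, norm_mul]
      gcongr
      simpa using hi
    exact mul_le_mul (this.trans (hS n)) (hM n) (norm_nonneg _) ((norm_nonneg _).trans (hS n))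
  have hzero : Tendsto (fun n => h n • Q n) atTop (𝓝 0) := by simpa using hh0.smul hQ
  have hlo : (fun n => NormedSpace.exp (h n • Q n) - 1 - h n • Q n) =o[atTop] h := by
    have h1 := (hasFDerivAt_exp_zero (𝕂 := ℝ) (𝔸 := Matrix (Fin d) (Fin d) ℝ)).isLittleO
    have h2 := h1.comp_tendsto hzero
    have h3 : (fun n => h n • Q n) =O[atTop] h := by
      refine Asymptotics.IsBigO.of_bound M (Eventually.of_forall fun n => ?_)
      rw [norm_smul, mul_comm]
      gcongr
      exact hM n
    refine (h2.trans_isBigO ?_).congr' ?_ EventuallyEq.rfl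
    · simpa [Function.comp_def] using h3
    · exact Eventually.of_forall fun n => by simp [NormedSpace.exp_zero]; rfl
  have hdiff : Tendsto (fun n => (1 + h n • Q n) ^ k n - NormedSpace.exp (h n • Q n) ^ k n) atTop
      (𝓝 0) := by
    have h1 : Tendsto (fun n => ‖NormedSpace.exp (h n • Q n) - 1 - h n • Q n‖ / h n) atTop
        (𝓝 0) := hlo.norm_left.tendsto_div_nhds_zero
    have h2 := (hk.mul h1).const_mul C
    rw [mul_zero, mul_zero] at h2
    refine squeeze_zero_norm (fun n => ?_) h2
    refine (norm_pow_sub_pow_le (hnorm n) (hB n)).trans (le_of_eq ?_)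
    have h3 : 1 + h n • Q n - NormedSpace.exp (h n • Q n)
        = -(NormedSpace.exp (h n • Q n) - 1 - h n • Q n) := by abel
    rw [h3, norm_neg]
    have := (hh n).ne'
    field_simp
  simpa using hdiff.add hexp

/-- The norm in scope is the maximal absolute row sum, for which stochastic matrices are
contractions. -/
theorem norm_le_one_of_mem_rowStochastic {P : Matrix (Fin d) (Fin d) ℝ}
    (hP : P ∈ Matrix.rowStochastic ℝ (Fin d)) : ‖P‖ ≤ 1 := by
  rw [Matrix.linfty_opNorm_def]
  norm_cast
  refine Finset.sup_le fun i _ => ?_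
  rw [← NNReal.coe_le_coe]
  push_cast
  rw [← Matrix.sum_row_of_mem_rowStochastic hP i]
  exact Finset.sum_le_sum fun j _ => by
    rw [Real.norm_of_nonneg (Matrix.nonneg_of_mem_rowStochastic hP)]

end MatrixExp

section Stochastic

variable {d : ℕ}

theorem tendsto_floor_mul {h : ℕ → ℝ} (hh : ∀ n, 0 < h n) (hh0 : Tendsto h atTop (𝓝 0))
    {s : ℝ} (hs : 0 ≤ s) : Tendsto (fun n => (⌊s / h n⌋₊ : ℝ) * h n) atTop (𝓝 s) := by
  refine tendsto_of_tendsto_of_tendsto_of_le_of_le (g := fun n => s - h n) (h := fun _ => s)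
    (by simpa using tendsto_const_nhds.sub hh0) tendsto_const_nhds (fun n => ?_) fun n => ?_
  · have h1 := Nat.lt_floor_add_one (s / h n)
    rw [div_lt_iff₀ (hh n)] at h1
    simp only; linarith
  · have h1 := Nat.floor_le (div_nonneg hs (hh n).le)
    rwa [le_div_iff₀ (hh n)] at h1

theorem tendsto_stochastic_pow_exp {Q : ℕ → Matrix (Fin d) (Fin d) ℝ}
    {Q₀ : Matrix (Fin d) (Fin d) ℝ} {h : ℕ → ℝ} {s : ℝ}
    (hh : ∀ n, 0 < h n) (hh0 : Tendsto h atTop (𝓝 0)) (hQ : Tendsto Q atTop (𝓝 Q₀))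
    (hP : ∀ n, h n • Q n + 1 ∈ Matrix.rowStochastic ℝ (Fin d)) (hs : 0 ≤ s) :
    Tendsto (fun n => (h n • Q n + 1) ^ ⌊s / h n⌋₊) atTop (𝓝 (NormedSpace.exp (s • Q₀))) := by
  have h1 := tendsto_one_add_smul_pow_exp hh hh0 hQ (fun n => by
    rw [add_comm]; exact norm_le_one_of_mem_rowStochastic (hP n)) (tendsto_floor_mul hh hh0 hs)
  simpa only [add_comm] using h1

end Stochastic

/-! ### Sums over a grid as integrals, and limits of integrals with uniform tails -/

/-- The right end point of the grid cell of mesh `h` that contains `s`. -/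
def stepTime (h s : ℝ) : ℝ := (⌊s / h⌋₊ + 1 : ℕ) * h

theorem lt_stepTime {h : ℝ} (hh : 0 < h) (s : ℝ) : s < stepTime h s := by
  have h1 := Nat.lt_floor_add_one (s / h)
  rw [div_lt_iff₀ hh] at h1
  simpa [stepTime] using h1

theorem stepTime_le {h s : ℝ} (hh : 0 < h) (hs : 0 ≤ s) : stepTime h s ≤ s + h := by
  have h1 := Nat.floor_le (div_nonneg hs hh.le)
  rw [le_div_iff₀ hh] at h1
  simp only [stepTime]
  push_cast
  linarith

theorem stepTime_pos {h s : ℝ} (hh : 0 < h) (hs : 0 ≤ s) : 0 < stepTime h s :=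
  hs.trans_lt (lt_stepTime hh s)

theorem tendsto_stepTime {h : ℕ → ℝ} (hh : ∀ n, 0 < h n) (hh0 : Tendsto h atTop (𝓝 0))
    {s : ℝ} (hs : 0 ≤ s) : Tendsto (fun n => stepTime (h n) s) atTop (𝓝 s) :=
  tendsto_of_tendsto_of_tendsto_of_le_of_le tendsto_const_nhds
    (by simpa using tendsto_const_nhds.add hh0)
    (fun n => (lt_stepTime (hh n) s).le) (fun n => stepTime_le (hh n) hs)

theorem measurable_floor_div (h : ℝ) : Measurable fun s : ℝ => ⌊s / h⌋₊ :=
  Nat.measurable_floor.comp (measurable_id.div_const h)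

/-- This turns sums over grids of different mesh into integrals over one half-line, where they can
be compared. -/
theorem map_floor_div {h : ℝ} (hh : 0 < h) :
    (volume.restrict (Ioi (0 : ℝ))).map (fun s => ⌊s / h⌋₊) = ENNReal.ofReal h • Measure.count := by
  rw [Measure.ext_iff_singleton]
  intro k
  rw [restrict_Ioi_eq_restrict_Ici, Measure.map_apply (measurable_floor_div h) (by simp),
    Measure.restrict_apply ((measurable_floor_div h) (by simp))]
  -- The intersection with `Ici 0` matters for `k = 0`, since the natural floor of a negative number
  -- is `0`.
  have h1 : (fun s : ℝ => ⌊s / h⌋₊) ⁻¹' {k} ∩ Ici 0 = Ico (k * h) ((k + 1) * h) := by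
    ext s
    simp only [mem_inter_iff, mem_preimage, mem_singleton_iff, mem_Ici, mem_Ico]
    constructor
    · rintro ⟨h1, h2⟩
      rw [Nat.floor_eq_iff (div_nonneg h2 hh.le), le_div_iff₀ hh, div_lt_iff₀ hh] at h1
      exact h1
    · intro h1
      have h2 : 0 ≤ s := le_trans (by positivity) h1.1
      rw [Nat.floor_eq_iff (div_nonneg h2 hh.le), le_div_iff₀ hh, div_lt_iff₀ hh]
      exact ⟨h1, h2⟩
  rw [h1, Real.volume_Ico]
  simp only [Measure.smul_apply, Measure.count_singleton, smul_eq_mul, mul_one]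
  congr 1
  ring

theorem lintegral_comp_floor_div {h : ℝ} (hh : 0 < h) (a : ℕ → ℝ≥0∞) :
    ∫⁻ s in Ioi (0 : ℝ), a ⌊s / h⌋₊ = ∑' k, ENNReal.ofReal h * a k := by
  rw [← lintegral_map (f := a) (measurable_of_countable _) (measurable_floor_div h),
    map_floor_div hh, lintegral_smul_measure, lintegral_count, ENNReal.tsum_mul_left, smul_eq_mul]

theorem integrable_comp_floor_div {h : ℝ} (hh : 0 < h) (a : ℕ → ℝ) :
    IntegrableOn (fun s => a ⌊s / h⌋₊) (Ioi 0) ↔ Summable a := by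
  rw [← summable_norm_iff, ← integrable_count_iff, IntegrableOn,
    ← integrable_smul_measure (f := a) (c := ENNReal.ofReal h) (by simpa using hh) (by simp),
    ← map_floor_div hh, integrable_map_measure (by fun_prop)
      (measurable_floor_div h).aemeasurable]
  rfl

theorem integral_comp_floor_div {h : ℝ} (hh : 0 < h) {a : ℕ → ℝ} (ha : Summable a) :
    ∫ s in Ioi (0 : ℝ), a ⌊s / h⌋₊ = h * ∑' k, a k := by
  have h1 : Integrable a Measure.count := by
    rw [integrable_count_iff]; exact ha.norm
  rw [← integral_map (φ := fun s : ℝ => ⌊s / h⌋₊) (f := a) (measurable_floor_div h).aemeasurable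
    (by fun_prop),
    map_floor_div hh, integral_smul_measure, integral_countable h1]
  simp [hh.le]

/-- A dominated convergence theorem on a half-line in which the domination at infinity is replaced
by uniformly small tails. -/
theorem tendsto_integral_of_uniform_tails {Φ : ℕ → ℝ → ℝ} {Φ₀ : ℝ → ℝ}
    (hmeas : ∀ n, Measurable (Φ n))
    (hlim : ∀ s, 0 < s → Tendsto (fun n => Φ n s) atTop (𝓝 (Φ₀ s)))
    (hbdd : ∀ T : ℝ, ∃ M : ℝ, ∀ n, ∀ s ∈ Ioc 0 T, ‖Φ n s‖ ≤ M)
    (htail : ∀ ε : ℝ, 0 < ε → ∃ T : ℝ, 0 ≤ T ∧ ∀ n, ∫⁻ s in Ioi T, ‖Φ n s‖ₑ ≤ ENNReal.ofReal ε) :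
    (∀ n, IntegrableOn (Φ n) (Ioi 0)) ∧ IntegrableOn Φ₀ (Ioi 0) ∧
      Tendsto (fun n => ∫ s in Ioi 0, Φ n s) atTop (𝓝 (∫ s in Ioi 0, Φ₀ s)) := by
  have hsplit : ∀ T : ℝ, 0 ≤ T → Ioi (0 : ℝ) = Ioc 0 T ∪ Ioi T :=
    fun T hT => (Ioc_union_Ioi_eq_Ioi hT).symm
  have haem : ∀ T : ℝ, 0 ≤ T → AEStronglyMeasurable Φ₀ (volume.restrict (Ioi T)) := by
    intro T hT
    refine aestronglyMeasurable_of_tendsto_ae atTop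
      (fun n => (hmeas n).aestronglyMeasurable) ?_
    filter_upwards [ae_restrict_mem measurableSet_Ioi] with s hs
    exact hlim s (hT.trans_lt hs)
  -- By Fatou's lemma the limit inherits the tail bounds.
  have htail₀ : ∀ ε : ℝ, ∀ T : ℝ, 0 ≤ T →
      (∀ n, ∫⁻ s in Ioi T, ‖Φ n s‖ₑ ≤ ENNReal.ofReal ε) →
      ∫⁻ s in Ioi T, ‖Φ₀ s‖ₑ ≤ ENNReal.ofReal ε := by
    intro ε T hT hn
    calc ∫⁻ s in Ioi T, ‖Φ₀ s‖ₑ = ∫⁻ s in Ioi T, liminf (fun n => ‖Φ n s‖ₑ) atTop := by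
          refine setLIntegral_congr_fun measurableSet_Ioi fun s hs => ?_
          exact ((hlim s (hT.trans_lt hs)).enorm.liminf_eq).symm
      _ ≤ liminf (fun n => ∫⁻ s in Ioi T, ‖Φ n s‖ₑ) atTop :=
          lintegral_liminf_le fun n => (hmeas n).enorm
      _ ≤ ENNReal.ofReal ε := by
          refine liminf_le_of_le (by isBoundedDefault) fun b hb => ?_
          obtain ⟨n, h1⟩ := hb.exists
          exact h1.trans (hn n)
  have hloc : ∀ T n, IntegrableOn (Φ n) (Ioc 0 T) := by
    intro T n
    obtain ⟨M, hM⟩ := hbdd T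
    refine Measure.integrableOn_of_bounded (M := M) (by simp) (hmeas n).aestronglyMeasurable ?_
    filter_upwards [ae_restrict_mem measurableSet_Ioc] with s hs
    exact hM n s hs
  have hlocint : ∀ T, Tendsto (fun n => ∫ s in Ioc 0 T, Φ n s) atTop (𝓝 (∫ s in Ioc 0 T, Φ₀ s)) ∧
      IntegrableOn Φ₀ (Ioc 0 T) := by
    intro T
    obtain ⟨M, hM⟩ := hbdd T
    constructor
    · refine tendsto_integral_of_dominated_convergence (fun _ => M)
        (fun n => (hmeas n).aestronglyMeasurable) (integrable_const _) (fun n => ?_) ?_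
      · filter_upwards [ae_restrict_mem measurableSet_Ioc] with s hs
        exact hM n s hs
      · filter_upwards [ae_restrict_mem measurableSet_Ioc] with s hs
        exact hlim s hs.1
    · refine Integrable.of_bound ((haem 0 le_rfl).mono_set Ioc_subset_Ioi_self) M ?_
      filter_upwards [ae_restrict_mem measurableSet_Ioc] with s hs
      exact le_of_tendsto (hlim s hs.1).norm (Eventually.of_forall fun n => hM n s hs)
  have hint : ∀ n, IntegrableOn (Φ n) (Ioi 0) := by
    intro n
    obtain ⟨T, hT, h1⟩ := htail 1 one_pos
    rw [hsplit T hT]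
    exact (hloc T n).union ⟨(hmeas n).aestronglyMeasurable, (h1 n).trans_lt (by simp)⟩
  have hint₀ : IntegrableOn Φ₀ (Ioi 0) := by
    obtain ⟨T, hT, h1⟩ := htail 1 one_pos
    rw [hsplit T hT]
    exact (hlocint T).2.union ⟨haem T hT, (htail₀ 1 T hT h1).trans_lt (by simp)⟩
  refine ⟨hint, hint₀, ?_⟩
  rw [Metric.tendsto_atTop]
  intro ε hε
  obtain ⟨T, hT, h1⟩ := htail (ε / 3) (by positivity)
  have hb : ∀ Ψ : ℝ → ℝ, ∫⁻ s in Ioi T, ‖Ψ s‖ₑ ≤ ENNReal.ofReal (ε / 3) →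
      |∫ s in Ioi T, Ψ s| ≤ ε / 3 := by
    intro Ψ hΨ
    have h2 := (enorm_integral_le_lintegral_enorm (μ := volume.restrict (Ioi T)) Ψ).trans hΨ
    rw [← ofReal_norm, ENNReal.ofReal_le_ofReal_iff (by positivity)] at h2
    exact h2
  obtain ⟨N, hN⟩ := (Metric.tendsto_atTop.1 (hlocint T).1) (ε / 3) (by positivity)
  refine ⟨N, fun n hn => ?_⟩
  have hd : Disjoint (Ioc 0 T) (Ioi T) := by
    rw [Set.disjoint_left]
    exact fun x hx hx' => not_lt.2 hx.2 hx'
  have hsub : Ioi T ⊆ Ioi 0 := Ioi_subset_Ioi hT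
  rw [hsplit T hT, setIntegral_union hd measurableSet_Ioi (hloc T n) ((hint n).mono_set hsub),
    setIntegral_union hd measurableSet_Ioi (hlocint T).2 (hint₀.mono_set hsub), Real.dist_eq]
  have h2 := hN n hn
  rw [Real.dist_eq] at h2
  have h3 := hb _ (h1 n)
  have h4 := hb _ (htail₀ _ T hT h1)
  rw [abs_lt] at h2 ⊢
  rw [abs_le] at h3 h4
  constructor <;> linarith [h2.1, h2.2, h3.1, h3.2, h4.1, h4.2]

/-! ### Regularity of the reward and the rates -/

section Reward

variable {d ℓ : ℕ} {U : Set (EuclideanSpace ℝ (Fin ℓ))}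
  {f : ℝ → Fin d → U → ℝ} {q : U → Matrix (Fin d) (Fin d) ℝ}

theorem UniformLipschitz.exists_nonneg (hLip : UniformLipschitz f q) :
    ∃ Θ : ℝ, 0 ≤ Θ ∧ (∀ t, 0 ≤ t → ∀ i, ∀ u₁ u₂ : U, |f t i u₁ - f t i u₂| ≤ Θ * dist u₁ u₂) ∧
      ∀ i j, ∀ u₁ u₂ : U, |q u₁ i j - q u₂ i j| ≤ Θ * dist u₁ u₂ := by
  obtain ⟨Θ, hΘ⟩ := hLip
  refine ⟨max Θ 0, le_max_right _ _, fun t ht i u₁ u₂ => ?_, fun i j u₁ u₂ => ?_⟩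
  · have h1 := hΘ t ht i u₁ u₂
    have h2 : Θ * dist u₁ u₂ ≤ max Θ 0 * dist u₁ u₂ := by gcongr; exact le_max_left _ _
    linarith [norm_nonneg (q u₁ i - q u₂ i)]
  · have h1 := hΘ 0 le_rfl i u₁ u₂
    have h2 : Θ * dist u₁ u₂ ≤ max Θ 0 * dist u₁ u₂ := by gcongr; exact le_max_left _ _
    have h3 := norm_le_pi_norm (q u₁ i - q u₂ i) j
    rw [Pi.sub_apply, Real.norm_eq_abs] at h3
    linarith [abs_nonneg (f 0 i u₁ - f 0 i u₂)]

theorem UniformLipschitz.continuous_rate (hLip : UniformLipschitz f q) (i j : Fin d) :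
    Continuous fun u => q u i j := by
  obtain ⟨Θ, hΘ0, -, hq⟩ := hLip.exists_nonneg
  refine LipschitzWith.continuous (K := Θ.toNNReal) (LipschitzWith.of_dist_le_mul fun u₁ u₂ => ?_)
  rw [Real.dist_eq, Real.coe_toNNReal _ hΘ0]
  exact hq i j u₁ u₂

/-- Continuity in time and a Lipschitz bound in the action that is uniform in time give joint
continuity. Clamping time at `0` makes the function continuous on all of `ℝ × U`. -/
theorem UniformLipschitz.continuous_reward (hLip : UniformLipschitz f q)
    (hfcont : ∀ i u, ContinuousOn (fun t => f t i u) (Ici 0)) (i : Fin d) :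
    Continuous fun p : ℝ × U => f (max p.1 0) i p.2 := by
  obtain ⟨Θ, hΘ0, hf, -⟩ := hLip.exists_nonneg
  have hsw : ContinuousOn (fun p : U × ℝ => f (max p.2 0) i p.1) (univ ×ˢ univ) := by
    refine continuousOn_prod_of_continuousOn_lipschitzOnWith _ Θ.toNNReal (fun u _ => ?_)
      fun t _ => ?_
    · exact ((hfcont i u).comp_continuous (by fun_prop) fun t => le_max_right t 0).continuousOn
    · refine (LipschitzWith.of_dist_le_mul fun u₁ u₂ => ?_).lipschitzOnWith
      rw [Real.dist_eq, Real.coe_toNNReal _ hΘ0]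
      exact hf _ (le_max_right t 0) i u₁ u₂
  rw [univ_prod_univ, continuousOn_univ] at hsw
  exact hsw.comp continuous_swap

theorem UniformLipschitz.continuous_reward_action (hLip : UniformLipschitz f q)
    (hfcont : ∀ i u, ContinuousOn (fun t => f t i u) (Ici 0)) (i : Fin d) {t : ℝ} (ht : 0 ≤ t) :
    Continuous (f t i) := by
  have h1 := (hLip.continuous_reward hfcont i).comp (Continuous.prodMk_right (X := ℝ) (Y := U) t)
  simpa [Function.comp_def, max_eq_left ht] using h1

theorem UniformLipschitz.exists_reward_bound [CompactSpace U] (hLip : UniformLipschitz f q)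
    (hfcont : ∀ i u, ContinuousOn (fun t => f t i u) (Ici 0)) (T : ℝ) :
    ∃ M : ℝ, 0 ≤ M ∧ ∀ t ∈ Icc 0 T, ∀ i u, |f t i u| ≤ M := by
  have h1 : ∀ i, ∃ M : ℝ, ∀ p ∈ Icc 0 T ×ˢ (univ : Set U), ‖f (max p.1 0) i p.2‖ ≤ M := fun i =>
    (isCompact_Icc.prod isCompact_univ).exists_bound_of_continuousOn
      (hLip.continuous_reward hfcont i).continuousOn
  choose M hM using h1
  refine ⟨∑ i, |M i|, Finset.sum_nonneg fun i _ => abs_nonneg _, fun t ht i u => ?_⟩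
  have h2 := hM i (t, u) ⟨ht, mem_univ _⟩
  rw [max_eq_left ht.1, Real.norm_eq_abs] at h2
  exact h2.trans ((le_abs_self _).trans
    (Finset.single_le_sum (f := fun i => |M i|) (fun i _ => abs_nonneg _) (Finset.mem_univ i)))

theorem supReward_le {t M : ℝ} (hM : ∀ i u, |f t i u| ≤ M) :
    supReward f t ≤ ENNReal.ofReal M := by
  refine iSup_le fun i => iSup_le fun u => ?_
  rw [← ofReal_norm]
  exact ENNReal.ofReal_le_ofReal (hM i u)

theorem enorm_avgReward_le (t : ℝ) (π : Control d U) (i : Fin d) :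
    ‖avgReward f t π i‖ₑ ≤ supReward f t := by
  refine (enorm_integral_le_lintegral_enorm _).trans ?_
  calc ∫⁻ u, ‖f t i u‖ₑ ∂(π i : Measure U) ≤ ∫⁻ _, supReward f t ∂(π i : Measure U) :=
        lintegral_mono fun u => (le_iSup (fun u => ‖f t i u‖ₑ) u).trans
          (le_iSup (fun i => ⨆ u, ‖f t i u‖ₑ) i)
    _ = supReward f t := by simp

/-- Cell `k` carries the reward at its right end `(k + 1) h`, so the integral is a sum shifted by
one index. A cell that meets `Ioi T` has its right end beyond `T`. -/
theorem lintegral_supReward_stepTime_le {h : ℝ} (hh : 0 < h) (T : ℝ) :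
    ∫⁻ s in Ioi T ∩ Ioi 0, supReward f (stepTime h s)
      ≤ ∑' k : ℕ, if T ≤ k * h then ENNReal.ofReal h * supReward f (k * h) else 0 := by
  let a : ℕ → ℝ≥0∞ := fun k => if T ≤ (k + 1 : ℕ) * h then supReward f ((k + 1 : ℕ) * h) else 0
  have h1 : ∫⁻ s in Ioi T ∩ Ioi 0, supReward f (stepTime h s) ≤
      ∫⁻ s in Ioi (0 : ℝ), a ⌊s / h⌋₊ := by
    have h2 : ∫⁻ s in Ioi T ∩ Ioi 0, supReward f (stepTime h s) =
        ∫⁻ s in Ioi T ∩ Ioi 0, a ⌊s / h⌋₊ := by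
      refine setLIntegral_congr_fun (measurableSet_Ioi.inter measurableSet_Ioi) fun s hs => ?_
      exact (if_pos (hs.1.le.trans (lt_stepTime hh s).le)).symm
    rw [h2]
    exact lintegral_mono_set inter_subset_right
  refine (h1.trans (lintegral_comp_floor_div hh a).le).trans ?_
  have h3 := ENNReal.tsum_comp_le_tsum_of_injective (add_left_injective 1)
    (fun k : ℕ => if T ≤ k * h then ENNReal.ofReal h * supReward f (k * h) else 0)
  refine le_trans (le_of_eq ?_) h3
  refine tsum_congr fun k => ?_
  simp only [a, mul_ite, mul_zero]

theorem UniformTails.lintegral_stepTime {h : ℕ → ℝ} (htail : UniformTails f h)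
    (hh : ∀ n, 0 < h n) {ε : ℝ} (hε : 0 < ε) :
    ∃ T : ℝ, 0 ≤ T ∧ ∀ n, ∫⁻ s in Ioi T, supReward f (stepTime (h n) s) ≤ ENNReal.ofReal ε := by
  obtain ⟨T, hT⟩ := htail ε hε
  refine ⟨max T 0, le_max_right _ _, fun n => ?_⟩
  rw [← Ioi_inter_Ioi]
  exact (lintegral_supReward_stepTime_le (hh n) T).trans (hT n)

theorem exists_lintegral_stepTime_le [CompactSpace U] (hLip : UniformLipschitz f q)
    (hfcont : ∀ i u, ContinuousOn (fun t => f t i u) (Ici 0)) {h : ℕ → ℝ}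
    (htail : UniformTails f h) (hh : ∀ n, h n ∈ Ioc (0 : ℝ) 1) :
    ∃ C : ℝ, 0 ≤ C ∧
      ∀ n, ∫⁻ s in Ioi 0, supReward f (stepTime (h n) s) ≤ ENNReal.ofReal C := by
  obtain ⟨T, hT, h1⟩ := htail.lintegral_stepTime (fun n => (hh n).1) one_pos
  -- For `s ≤ T` the right end of the cell is at most `T + h ≤ T + 1`.
  obtain ⟨M, hM0, hM⟩ := hLip.exists_reward_bound hfcont (T + 1)
  refine ⟨M * T + 1, by positivity, fun n => ?_⟩
  rw [← Ioc_union_Ioi_eq_Ioi hT]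
  refine (lintegral_union_le _ _ _).trans ?_
  rw [ENNReal.ofReal_add (by positivity) zero_le_one]
  refine add_le_add ?_ (h1 n)
  calc ∫⁻ s in Ioc 0 T, supReward f (stepTime (h n) s) ≤ ∫⁻ _ in Ioc 0 T, ENNReal.ofReal M := by
        refine setLIntegral_mono measurable_const fun s hs => supReward_le (hM _ ⟨?_, ?_⟩)
        · exact (stepTime_pos (hh n).1 hs.1.le).le
        · exact (stepTime_le (hh n).1 hs.1.le).trans (add_le_add hs.2 (hh n).2)
    _ = ENNReal.ofReal (M * T) := by
        rw [setLIntegral_const, Real.volume_Ioc, sub_zero, ENNReal.ofReal_mul hM0]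

/-- Averages of a reward that varies with time converge along weakly convergent controls. -/
theorem tendsto_avgReward [CompactSpace U] (hLip : UniformLipschitz f q)
    (hfcont : ∀ i u, ContinuousOn (fun t => f t i u) (Ici 0)) {α : Type*} {F : Filter α}
    {π : α → Control d U} {π₀ : Control d U} (i : Fin d)
    (hπ : Tendsto (fun n => π n i) F (𝓝 (π₀ i))) {t : α → ℝ} {t₀ : ℝ}
    (ht : ∀ n, 0 ≤ t n) (ht₀ : 0 ≤ t₀) (htt : Tendsto t F (𝓝 t₀)) :
    Tendsto (fun n => avgReward f (t n) (π n) i) F (𝓝 (avgReward f t₀ π₀ i)) := by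
  -- Since `U` is compact, currying turns convergence of times into convergence uniform in the
  -- action. The change of integrand is thereby separated from the change of measure.
  let g : C(ℝ × U, ℝ) := ⟨_, hLip.continuous_reward hfcont i⟩
  have hg : ∀ s, 0 ≤ s → ∀ u, g.curry s u = f s i u := fun s hs u => by
    simp [g, max_eq_left hs]
  have hgt : Tendsto (fun n => dist (g.curry (t n)) (g.curry t₀)) F (𝓝 0) :=
    tendsto_iff_dist_tendsto_zero.1 ((g.curry.continuous.tendsto t₀).comp htt)
  have hint : ∀ s n, Integrable (g.curry s) (π n i : Measure U) := fun s n =>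
    (BoundedContinuousFunction.mkOfCompact (g.curry s)).integrable _
  have h1 := ProbabilityMeasure.tendsto_iff_forall_integral_tendsto.1 hπ
    (BoundedContinuousFunction.mkOfCompact (g.curry t₀))
  have h2 : Tendsto (fun n => (∫ u, g.curry (t n) u ∂(π n i : Measure U))
      - ∫ u, g.curry t₀ u ∂(π n i : Measure U)) F (𝓝 0) := by
    refine squeeze_zero_norm (fun n => ?_) hgt
    rw [← integral_sub (hint _ _) (hint _ _)]
    refine (norm_integral_le_of_norm_le_const (C := dist (g.curry (t n)) (g.curry t₀))
      (Eventually.of_forall fun u => ?_)).trans (by simp)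
    rw [← dist_eq_norm]
    exact ContinuousMap.dist_apply_le_dist u
  have h3 := h2.add h1
  simp only [BoundedContinuousFunction.mkOfCompact_apply, sub_add_cancel, zero_add] at h3
  simpa only [avgReward, hg _ (ht _), hg _ ht₀] using h3

theorem tendsto_avgMatrix [CompactSpace U] (hLip : UniformLipschitz f q) {α : Type*}
    {F : Filter α} {π : α → Control d U} {π₀ : Control d U}
    (hπ : ∀ i, Tendsto (fun n => π n i) F (𝓝 (π₀ i))) :
    Tendsto (fun n => avgMatrix q (π n)) F (𝓝 (avgMatrix q π₀)) := by
  refine tendsto_pi_nhds.2 fun i => tendsto_pi_nhds.2 fun j => ?_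
  exact ProbabilityMeasure.tendsto_iff_forall_integral_tendsto.1 (hπ i)
    (BoundedContinuousFunction.mkOfCompact ⟨_, hLip.continuous_rate i j⟩)

theorem integrable_of_continuous [CompactSpace U] {g : U → ℝ} (hg : Continuous g)
    (μ : Measure U) [IsFiniteMeasure μ] : Integrable g μ :=
  (BoundedContinuousFunction.mkOfCompact (⟨g, hg⟩ : C(U, ℝ))).integrable μ

theorem avgMatrix_stepMatrix [CompactSpace U] (hLip : UniformLipschitz f q) (h : ℝ)
    (π : Control d U) : avgMatrix (stepMatrix h q) π = h • avgMatrix q π + 1 := by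
  ext i j
  have h1 := integrable_of_continuous (hLip.continuous_rate i j) (π i : Measure U)
  simp only [avgMatrix, stepMatrix, Matrix.of_apply, Matrix.add_apply, Matrix.smul_apply,
    smul_eq_mul]
  rw [integral_add (h1.const_mul h) (integrable_const _), integral_const_mul]
  simp

theorem avgMatrix_step_mem_rowStochastic [CompactSpace U] (hLip : UniformLipschitz f q)
    (hq : ∀ u, IsRateMatrix (q u)) {h : ℝ} (hh : 0 < h)
    (hstoch : ∀ u i, 0 ≤ stepMatrix h q u i i) (π : Control d U) :
    h • avgMatrix q π + 1 ∈ Matrix.rowStochastic ℝ (Fin d) := by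
  rw [← avgMatrix_stepMatrix hLip, Matrix.mem_rowStochastic_iff_sum]
  refine ⟨fun i j => integral_nonneg fun u => ?_, fun i => ?_⟩
  · by_cases hij : j = i
    · subst hij; exact hstoch u j
    · have h1 := (hq u).1 i j hij
      simp only [stepMatrix, Matrix.add_apply, Matrix.smul_apply, smul_eq_mul, Pi.zero_apply]
      rw [Matrix.one_apply_ne (Ne.symm hij), add_zero]
      positivity
  · have h1 : ∀ j, Integrable (fun u => stepMatrix h q u i j) (π i : Measure U) := fun j =>
      integrable_of_continuous (by
        simp only [stepMatrix, Matrix.add_apply, Matrix.smul_apply, smul_eq_mul]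
        exact ((hLip.continuous_rate i j).const_smul h).add continuous_const) _
    simp only [avgMatrix, Matrix.of_apply]
    rw [← integral_finsetSum _ fun j _ => h1 j]
    have h2 : ∀ u, ∑ j, stepMatrix h q u i j = 1 := fun u => by
      have h3 : ∑ j, q u i j = 0 := by
        rw [← Finset.add_sum_erase _ _ (Finset.mem_univ i), (hq u).2 i]
        ring
      simp [stepMatrix, Finset.sum_add_distrib, ← Finset.mul_sum, h3, Matrix.one_apply]
    simp [h2]

end Reward

/-! ### The value at time `1` of the discretized problem and its limit -/

section GridValue

variable {d ℓ : ℕ} {U : Set (EuclideanSpace ℝ (Fin ℓ))}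
  {f : ℝ → Fin d → U → ℝ} {q : U → Matrix (Fin d) (Fin d) ℝ} {δ : ℝ → ℝ}

/-- The expected reward rate `k` steps after time `h`, for the chain with transition matrix
`h Q + I` that is in state `j` at time `h`. -/
def gridTerm (h : ℝ) (Q : Matrix (Fin d) (Fin d) ℝ) (r : ℝ → Fin d → ℝ) (j : Fin d) (k : ℕ) : ℝ :=
  ∑ l, ((h • Q + 1) ^ k) j l * r ((k + 1 : ℕ) * h) l

/-- The expected reward collected from time `h` on by the discretized chain. -/
def gridValue (h : ℝ) (Q : Matrix (Fin d) (Fin d) ℝ) (r : ℝ → Fin d → ℝ) (j : Fin d) : ℝ :=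
  h * ∑' k, gridTerm h Q r j k

theorem integrableOn_discount (hint : IntegrableReward f δ) (hδcont : ContinuousOn δ (Ici 0)) :
    IntegrableOn δ (Ioi 0) := by
  refine IntegrableOn.mono_set (t := Ici 0)
    ⟨hδcont.aestronglyMeasurable measurableSet_Ici, ?_⟩ Ioi_subset_Ici_self
  exact (lintegral_mono fun s => le_add_self).trans_lt hint

theorem enorm_sum_mul_le {P : Matrix (Fin d) (Fin d) ℝ}
    (hP : P ∈ Matrix.rowStochastic ℝ (Fin d)) {r : Fin d → ℝ} {B : ℝ≥0∞}
    (hr : ∀ l, ‖r l‖ₑ ≤ B) (j : Fin d) : ‖∑ l, P j l * r l‖ₑ ≤ B := by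
  calc ‖∑ l, P j l * r l‖ₑ ≤ ∑ l, ENNReal.ofReal (P j l) * B := by
        refine (enorm_sum_le _ _).trans (Finset.sum_le_sum fun l _ => ?_)
        rw [enorm_mul, Real.enorm_of_nonneg (Matrix.nonneg_of_mem_rowStochastic hP)]
        gcongr
        exact hr l
    _ = B := by
        rw [← Finset.sum_mul, ← ENNReal.ofReal_sum_of_nonneg
          fun l _ => Matrix.nonneg_of_mem_rowStochastic hP,
          Matrix.sum_row_of_mem_rowStochastic hP, ENNReal.ofReal_one, one_mul]

theorem enorm_avgRewardEnt_le (hδ : IsDiscount δ) {lam E : ℝ} {π : Control d U}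
    (hE : ∀ i, |lam * entropy (π i)| ≤ E) {t : ℝ} (ht : 0 ≤ t) (i : Fin d) :
    ‖avgRewardEnt f δ lam t π i‖ₑ ≤ supReward f t + ENNReal.ofReal (E * δ t) := by
  refine (enorm_add_le _ _).trans (add_le_add (enorm_avgReward_le t π i) ?_)
  rw [← ofReal_norm]
  refine ENNReal.ofReal_le_ofReal ?_
  have h1 : lam * δ t * entropy (π i) = (lam * entropy (π i)) * δ t := by ring
  have h2 := (hδ.1 t ht).1
  rw [h1, Real.norm_eq_abs, abs_mul, abs_of_nonneg h2]
  gcongr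
  exact hE i

/-- Averaging by a stochastic matrix preserves uniform bounds. Since `δ` is nonincreasing, its value
at the right end of a cell is at most `δ s`, so integrability of `δ` alone controls the discretized
entropy terms. -/
theorem lintegral_gridTerm_le (hδ : IsDiscount δ) (hδint : IntegrableOn δ (Ioi 0)) {h : ℝ}
    (hh : 0 < h) {Q : Matrix (Fin d) (Fin d) ℝ}
    (hP : h • Q + 1 ∈ Matrix.rowStochastic ℝ (Fin d)) {r : ℝ → Fin d → ℝ} {E : ℝ} (hE : 0 ≤ E)
    (hr : ∀ t, 0 ≤ t → ∀ l, ‖r t l‖ₑ ≤ supReward f t + ENNReal.ofReal (E * δ t))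
    (j : Fin d) {T : ℝ} (hT : 0 ≤ T) :
    ∫⁻ s in Ioi T, ‖gridTerm h Q r j ⌊s / h⌋₊‖ₑ ≤
      (∫⁻ s in Ioi T, supReward f (stepTime h s)) + ENNReal.ofReal (E * ∫ s in Ioi T, δ s) := by
  have hmeas : Measurable fun s => supReward f (stepTime h s) :=
    (measurable_of_countable fun k : ℕ => supReward f ((k + 1 : ℕ) * h)).comp
      (measurable_floor_div h)
  have hδT : IntegrableOn δ (Ioi T) := hδint.mono_set (Ioi_subset_Ioi hT)
  rw [← integral_const_mul, ofReal_integral_eq_lintegral_ofReal (hδT.const_mul E) (by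
    filter_upwards [ae_restrict_mem measurableSet_Ioi] with s hs
    exact mul_nonneg hE (hδ.1 s (hT.trans hs.le)).1), ← lintegral_add_left hmeas]
  refine setLIntegral_mono_ae
    (hmeas.aemeasurable.add (hδT.const_mul E).aestronglyMeasurable.aemeasurable.ennreal_ofReal)
    (Eventually.of_forall fun s hs => ?_)
  have hs0 : 0 ≤ s := hT.trans (le_of_lt hs)
  refine (enorm_sum_mul_le (pow_mem hP _) (hr _ (stepTime_pos hh hs0).le) j).trans ?_
  refine add_le_add le_rfl (ENNReal.ofReal_le_ofReal (mul_le_mul_of_nonneg_left ?_ hE))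
  exact hδ.2.1 hs0 (stepTime_pos hh hs0).le (lt_stepTime hh s).le

/-- Summability of the discretized rewards, and a bound for the value. -/
theorem summable_gridTerm_and_le (hδ : IsDiscount δ) (hδint : IntegrableOn δ (Ioi 0)) {h : ℝ}
    (hh : 0 < h) {C : ℝ} (hC0 : 0 ≤ C)
    (hC : ∫⁻ s in Ioi 0, supReward f (stepTime h s) ≤ ENNReal.ofReal C)
    {Q : Matrix (Fin d) (Fin d) ℝ}
    (hP : h • Q + 1 ∈ Matrix.rowStochastic ℝ (Fin d)) {r : ℝ → Fin d → ℝ} {E : ℝ} (hE : 0 ≤ E)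
    (hr : ∀ t, 0 ≤ t → ∀ l, ‖r t l‖ₑ ≤ supReward f t + ENNReal.ofReal (E * δ t)) (j : Fin d) :
    Summable (gridTerm h Q r j) ∧ |gridValue h Q r j| ≤ C + E * ∫ s in Ioi 0, δ s := by
  have hδ0 : 0 ≤ ∫ s in Ioi 0, δ s :=
    setIntegral_nonneg measurableSet_Ioi fun s hs => (hδ.1 s (le_of_lt hs)).1
  have h1 : ∫⁻ s in Ioi 0, ‖gridTerm h Q r j ⌊s / h⌋₊‖ₑ ≤
      ENNReal.ofReal (C + E * ∫ s in Ioi 0, δ s) := by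
    rw [ENNReal.ofReal_add hC0 (by positivity)]
    exact (lintegral_gridTerm_le hδ hδint hh hP hE hr j le_rfl).trans (by gcongr)
  have h2 : IntegrableOn (fun s => gridTerm h Q r j ⌊s / h⌋₊) (Ioi 0) :=
    ⟨((measurable_of_countable (gridTerm h Q r j)).comp
      (measurable_floor_div h)).aestronglyMeasurable, h1.trans_lt ENNReal.ofReal_lt_top⟩
  have h3 := (integrable_comp_floor_div hh _).1 h2
  refine ⟨h3, ?_⟩
  rw [gridValue, ← integral_comp_floor_div hh h3]
  have h4 := (enorm_integral_le_lintegral_enorm (μ := volume.restrict (Ioi 0))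
    fun s => gridTerm h Q r j ⌊s / h⌋₊).trans h1
  rwa [← ofReal_norm, ENNReal.ofReal_le_ofReal_iff (by positivity)] at h4

theorem tendsto_integral_Ioi_discount (hδint : IntegrableOn δ (Ioi 0)) :
    Tendsto (fun T => ∫ s in Ioi T, δ s) atTop (𝓝 0) := by
  have h1 := intervalIntegral_tendsto_integral_Ioi 0 hδint tendsto_id
  have h2 := (tendsto_const_nhds (x := ∫ s in Ioi 0, δ s)).sub h1
  rw [sub_self] at h2
  refine h2.congr' ?_
  filter_upwards [eventually_ge_atTop 0] with T hT
  rw [id, ← intervalIntegral.integral_Ioi_sub_Ioi hδint hT]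
  ring

/-- The values of the discretized problems converge to the value of the limiting control. -/
theorem tendsto_gridValue [CompactSpace U] (hLip : UniformLipschitz f q)
    (hq : ∀ u, IsRateMatrix (q u))
    (hfcont : ∀ i u, ContinuousOn (fun t => f t i u) (Ici 0))
    (hδ : IsDiscount δ) (hδcont : ContinuousOn δ (Ici 0)) (hδint : IntegrableOn δ (Ioi 0))
    {h : ℕ → ℝ} (hh : ∀ n, h n ∈ Ioc (0 : ℝ) 1) (hh0 : Tendsto h atTop (𝓝 0))
    (hstoch : ∀ n u i, 0 ≤ stepMatrix (h n) q u i i)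
    (htail : UniformTails f h) {lam : ℝ} {π : ℕ → Control d U} {π₀ : Control d U}
    (hπ : ∀ i, Tendsto (fun n => π n i) atTop (𝓝 (π₀ i)))
    (hent : ∀ i, Tendsto (fun n => lam * entropy (π n i)) atTop (𝓝 (lam * entropy (π₀ i))))
    (j : Fin d) :
    IntegrableOn (fun s => ∑ l, contTrans q π₀ s j l * avgRewardEnt f δ lam s π₀ l) (Ioi 0) ∧
    Tendsto (fun n => gridValue (h n) (avgMatrix q (π n))
        (fun t l => avgRewardEnt f δ lam t (π n) l) j) atTop
      (𝓝 (contValue q (avgRewardEnt f δ lam) π₀ j)) := by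
  have hpos := fun n => (hh n).1
  have hP := fun n => avgMatrix_step_mem_rowStochastic hLip hq (hpos n) (hstoch n) (π n)
  obtain ⟨E, hE0, hE⟩ : ∃ E : ℝ, 0 ≤ E ∧ ∀ n i, |lam * entropy (π n i)| ≤ E := by
    have h1 : ∀ i, ∃ E : ℝ, ∀ n, |lam * entropy (π n i)| ≤ E := fun i => by
      obtain ⟨M, hM⟩ := (Metric.isBounded_range_of_tendsto _ (hent i)).exists_norm_le
      exact ⟨M, fun n => hM _ (mem_range_self n)⟩
    choose E hE using h1
    refine ⟨∑ i, |E i|, Finset.sum_nonneg fun i _ => abs_nonneg _, fun n i => ?_⟩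
    exact ((hE i n).trans (le_abs_self _)).trans
      (Finset.single_le_sum (f := fun i => |E i|) (fun i _ => abs_nonneg _) (Finset.mem_univ i))
  have hr := fun n t ht l => enorm_avgRewardEnt_le (f := f) hδ (hE n) (t := t) ht l
  set Φ : ℕ → ℝ → ℝ := fun n s => gridTerm (h n) (avgMatrix q (π n))
    (fun t l => avgRewardEnt f δ lam t (π n) l) j ⌊s / h n⌋₊ with hΦ
  have hlim : ∀ s, 0 < s → Tendsto (fun n => Φ n s) atTop
      (𝓝 (∑ l, contTrans q π₀ s j l * avgRewardEnt f δ lam s π₀ l)) := by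
    intro s hs
    refine tendsto_finsetSum _ fun l _ => Tendsto.mul ?_ ?_
    · exact tendsto_pi_nhds.1 (tendsto_pi_nhds.1
        (tendsto_stochastic_pow_exp hpos hh0 (tendsto_avgMatrix hLip hπ) hP hs.le) j) l
    · have hst := tendsto_stepTime hpos hh0 hs.le
      refine (tendsto_avgReward hLip hfcont l (hπ l) (fun n => (stepTime_pos (hpos n) hs.le).le)
        hs.le hst).add ?_
      have h1 : Tendsto (fun n => δ (stepTime (h n) s)) atTop (𝓝 (δ s)) :=
        (hδcont s hs.le).tendsto.comp (tendsto_nhdsWithin_iff.2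
          ⟨hst, Eventually.of_forall fun n => (stepTime_pos (hpos n) hs.le).le⟩)
      refine ((hent l).mul h1).congr' ?_ |>.trans (le_of_eq ?_)
      · exact Eventually.of_forall fun n => by
          simp only [stepTime]; ring
      · congr 1; ring
  have hbdd : ∀ T : ℝ, ∃ M : ℝ, ∀ n, ∀ s ∈ Ioc 0 T, ‖Φ n s‖ ≤ M := by
    intro T
    obtain ⟨M, hM0, hM⟩ := hLip.exists_reward_bound hfcont (T + 1)
    refine ⟨M + E, fun n s hs => ?_⟩
    have hst0 := (stepTime_pos (hpos n) hs.1.le).le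
    have hst1 : stepTime (h n) s ≤ T + 1 :=
      (stepTime_le (hpos n) hs.1.le).trans (add_le_add hs.2 (hh n).2)
    have h1 : ‖Φ n s‖ₑ ≤ ENNReal.ofReal (M + E) := by
      refine enorm_sum_mul_le (pow_mem (hP n) _) (fun l => (hr n _ hst0 l).trans ?_) j
      rw [ENNReal.ofReal_add hM0 hE0]
      refine add_le_add (supReward_le (hM _ ⟨hst0, hst1⟩)) (ENNReal.ofReal_le_ofReal ?_)
      exact mul_le_of_le_one_right hE0 (hδ.1 _ hst0).2
    rwa [← ofReal_norm, ENNReal.ofReal_le_ofReal_iff (by positivity)] at h1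
  have htails : ∀ ε : ℝ, 0 < ε →
      ∃ T : ℝ, 0 ≤ T ∧ ∀ n, ∫⁻ s in Ioi T, ‖Φ n s‖ₑ ≤ ENNReal.ofReal ε := by
    intro ε hε
    obtain ⟨T₁, hT₁, h1⟩ := htail.lintegral_stepTime hpos (half_pos hε)
    have h2 := (tendsto_integral_Ioi_discount hδint).const_mul E
    rw [mul_zero] at h2
    -- Beyond `T` the rewards and the entropy terms contribute at most `ε / 2` each, uniformly in
    -- `n` because `E` bounds all the entropies.
    obtain ⟨T, hT, hT'⟩ := ((h2.eventually_lt_const (half_pos hε)).and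
      (eventually_ge_atTop T₁)).exists
    refine ⟨T, hT₁.trans hT', fun n => ?_⟩
    refine (lintegral_gridTerm_le hδ hδint (hpos n) (hP n) hE0 (hr n) j (hT₁.trans hT')).trans ?_
    rw [← add_halves ε, ENNReal.ofReal_add (by positivity) (by positivity)]
    exact add_le_add ((lintegral_mono_set (Ioi_subset_Ioi hT')).trans (h1 n))
      (ENNReal.ofReal_le_ofReal hT.le)
  have hmeas : ∀ n, Measurable (Φ n) := fun n =>
    (measurable_of_countable (gridTerm (h n) (avgMatrix q (π n))
      (fun t l => avgRewardEnt f δ lam t (π n) l) j)).comp (measurable_floor_div (h n))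
  obtain ⟨h1, h2, h3⟩ := tendsto_integral_of_uniform_tails hmeas hlim hbdd htails
  refine ⟨h2, h3.congr fun n => ?_⟩
  exact integral_comp_floor_div (hpos n) ((integrable_comp_floor_div (hpos n) _).1 (h1 n))

end GridValue

/-! ### Verification of the continuous-time equilibrium condition -/

section ContinuousTime

variable {d ℓ : ℕ} {U : Set (EuclideanSpace ℝ (Fin ℓ))}
  {f : ℝ → Fin d → U → ℝ} {q : U → Matrix (Fin d) (Fin d) ℝ} {δ : ℝ → ℝ}

theorem contTrans_add (q : U → Matrix (Fin d) (Fin d) ℝ) (π : Control d U) (s t : ℝ) :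
    contTrans q π (s + t) = contTrans q π s * contTrans q π t := by
  rw [contTrans, add_smul, Matrix.exp_add_of_commute]
  · rfl
  · exact ((Commute.refl _).smul_left _).smul_right _

theorem contTrans_zero (q : U → Matrix (Fin d) (Fin d) ℝ) (π : Control d U) :
    contTrans q π 0 = 1 := by
  simp [contTrans]

open scoped Matrix.Norms.Operator in
theorem continuous_contTrans (q : U → Matrix (Fin d) (Fin d) ℝ) (π : Control d U) :
    Continuous (contTrans q π) :=
  NormedSpace.exp_continuous.comp (continuous_id.smul continuous_const)

theorem continuous_contTrans_apply (q : U → Matrix (Fin d) (Fin d) ℝ) (π : Control d U)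
    (i j : Fin d) : Continuous fun s => contTrans q π s i j :=
  (continuous_contTrans q π).matrix_elem i j

open scoped Matrix.Norms.Operator in
theorem tendsto_contTrans_slope (q : U → Matrix (Fin d) (Fin d) ℝ) (π : Control d U) (i j : Fin d) :
    Tendsto (fun ε => ε⁻¹ * (contTrans q π ε i j - (1 : Matrix (Fin d) (Fin d) ℝ) i j)) (𝓝[>] 0)
      (𝓝 (avgMatrix q π i j)) := by
  have h1 := hasDerivAt_exp_smul_const (𝕂 := ℝ) (avgMatrix q π) (0 : ℝ)
  rw [hasDerivAt_iff_tendsto_slope_zero] at h1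
  have h2 := h1.mono_left (nhdsWithin_mono 0 fun x (hx : x ∈ Ioi 0) => ne_of_gt hx)
  have h3 := ((Continuous.matrix_elem continuous_id i j).tendsto _).comp h2
  refine (h3.congr fun ε => ?_).trans (le_of_eq ?_)
  · simp only [Function.comp_apply, id, zero_add, zero_smul, NormedSpace.exp_zero, contTrans]
    rfl
  · simp

theorem tendsto_average_integral {a : ℝ → ℝ} (ha : ContinuousOn a (Ici 0)) :
    Tendsto (fun ε => ε⁻¹ * ∫ s in Ioc 0 ε, a s) (𝓝[>] 0) (𝓝 (a 0)) := by
  have hc : Continuous fun s => a (max s 0) :=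
    ha.comp_continuous (by fun_prop) fun s => le_max_right s 0
  have h1 : HasDerivAt (fun ε => ∫ s in (0 : ℝ)..ε, a (max s 0)) (a (max 0 0)) 0 :=
    intervalIntegral.integral_hasDerivAt_right (hc.intervalIntegrable _ _)
      (hc.stronglyMeasurableAtFilter _ _) hc.continuousAt
  rw [hasDerivAt_iff_tendsto_slope_zero] at h1
  have h2 := h1.mono_left (nhdsWithin_mono 0 fun x (hx : x ∈ Ioi 0) => ne_of_gt hx)
  rw [max_self] at h2
  refine h2.congr' ?_
  filter_upwards [self_mem_nhdsWithin] with ε hε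
  rw [zero_add, intervalIntegral.integral_same, sub_zero, smul_eq_mul,
    intervalIntegral.integral_of_le (le_of_lt hε)]
  congr 1
  refine setIntegral_congr_fun measurableSet_Ioc fun s hs => ?_
  simp only [max_eq_left hs.1.le]

theorem continuousOn_avgRewardEnt [CompactSpace U] (hLip : UniformLipschitz f q)
    (hfcont : ∀ i u, ContinuousOn (fun t => f t i u) (Ici 0)) (hδcont : ContinuousOn δ (Ici 0))
    (lam : ℝ) (π : Control d U) (i : Fin d) :
    ContinuousOn (fun t => avgRewardEnt f δ lam t π i) (Ici 0) := by
  have h1 : Continuous fun t : ℝ => avgReward f (max t 0) π i :=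
    continuous_iff_continuousAt.2 fun t =>
      tendsto_avgReward hLip hfcont i tendsto_const_nhds (fun t => le_max_right t 0)
        (le_max_right t 0) ((by fun_prop : Continuous fun t : ℝ => max t 0).tendsto t)
  refine ContinuousOn.add (h1.continuousOn.congr fun t ht => ?_)
    ((continuousOn_const.mul hδcont).mul continuousOn_const)
  simp only [max_eq_left (mem_Ici.1 ht)]

/-- If `π` maximizes the instantaneous reward rate plus the drift of its own value at time `0`,
then `π` is an equilibrium. -/
theorem isContEquilibrium_of_forall_le {r : ℝ → Control d U → Fin d → ℝ} {A : Set (Control d U)}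
    {π : Control d U} (hr : ∀ π' i, ContinuousOn (fun t => r t π' i) (Ici 0)) (hπ : π ∈ A)
    (hint : ∀ j, IntegrableOn (fun s => ∑ l, contTrans q π s j l * r s π l) (Ioi 0))
    (hmax : ∀ π' ∈ A, ∀ i,
      r 0 π' i + ∑ j, avgMatrix q π' i j * contValue q r π j ≤
        r 0 π i + ∑ j, avgMatrix q π i j * contValue q r π j) :
    IsContEquilibrium A q r π := by
  refine ⟨hπ, fun π' hπ' i => ?_⟩
  let a : Control d U → Fin d → ℝ → ℝ := fun σ j s => ∑ l, contTrans q σ s j l * r s σ l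
  have ha : ∀ σ j, ContinuousOn (a σ j) (Ici 0) := fun σ j =>
    continuousOn_finsetSum _ fun l _ =>
      (continuous_contTrans_apply q σ j l).continuousOn.mul (hr σ l)
  have haI : ∀ σ j ε, IntegrableOn (a σ j) (Ioc 0 ε) := fun σ j ε =>
    (((ha σ j).mono Icc_subset_Ici_self).integrableOn_Icc).mono_set Ioc_subset_Icc_self
  have ha0 : ∀ σ j, a σ j 0 = r 0 σ j := fun σ j => by
    simp [a, contTrans_zero, Matrix.one_apply]
  -- the value from time `ε` on
  let W : ℝ → Fin d → ℝ := fun ε m => ∑ l, contTrans q π (-ε) m l * ∫ s in Ioi ε, a π l s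
  -- The exponential is defined for negative times too: factoring `P(s - ε) = P(-ε) P(s)` removes
  -- `ε` from the integrand, so that only the domain of integration depends on it.
  have hsh : ∀ ε s m, ∑ l, contTrans q π (s - ε) m l * r s π l =
      ∑ l, contTrans q π (-ε) m l * a π l s := by
    intro ε s m
    have h1 : s - ε = -ε + s := by ring
    simp only [a, h1, contTrans_add, Matrix.mul_apply, Finset.sum_mul, Finset.mul_sum]
    rw [Finset.sum_comm]
    exact Finset.sum_congr rfl fun _ _ => Finset.sum_congr rfl fun _ _ => mul_assoc _ _ _
  have hmul : ∀ (M : Matrix (Fin d) (Fin d) ℝ) ε s,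
      ∑ l, (M * contTrans q π (s - ε)) i l * r s π l =
        ∑ m, M i m * ∑ l, contTrans q π (-ε) m l * a π l s := by
    intro M ε s
    simp only [← hsh, Matrix.mul_apply, Finset.sum_mul, Finset.mul_sum]
    rw [Finset.sum_comm]
    exact Finset.sum_congr rfl fun _ _ => Finset.sum_congr rfl fun _ _ => mul_assoc _ _ _
  -- `M` will be the transition matrix up to time `ε` under `π` or `π'`; the continuation `W` is
  -- common to both.
  have htailint : ∀ (M : Matrix (Fin d) (Fin d) ℝ) ε, 0 < ε →
      IntegrableOn (fun s => ∑ l, (M * contTrans q π (s - ε)) i l * r s π l) (Ioi ε) ∧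
      ∫ s in Ioi ε, ∑ l, (M * contTrans q π (s - ε)) i l * r s π l = ∑ m, M i m * W ε m := by
    intro M ε hε
    have hI : ∀ l, IntegrableOn (a π l) (Ioi ε) := fun l =>
      (hint l).mono_set (Ioi_subset_Ioi hε.le)
    have hI2 : ∀ m, IntegrableOn (fun s => ∑ l, contTrans q π (-ε) m l * a π l s) (Ioi ε) :=
      fun m => integrable_finsetSum _ fun l _ => (hI l).const_mul _
    simp only [hmul]
    refine ⟨integrable_finsetSum _ fun m _ => (hI2 m).const_mul _, ?_⟩
    rw [integral_finsetSum _ fun m _ => (hI2 m).const_mul _]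
    refine Finset.sum_congr rfl fun m _ => ?_
    rw [integral_const_mul, integral_finsetSum _ fun l _ => (hI l).const_mul _]
    simp only [W, integral_const_mul]
  have hd : ∀ ε : ℝ, Disjoint (Ioc 0 ε) (Ioi ε) := fun ε => by
    rw [Set.disjoint_left]
    exact fun x hx hx' => not_lt.2 hx.2 hx'
  have hval : ∀ ε, 0 < ε → contValue q r π i =
      (∫ s in Ioc 0 ε, a π i s) + ∑ m, contTrans q π ε i m * W ε m := by
    intro ε hε
    rw [contValue, ← Ioc_union_Ioi_eq_Ioi hε.le,
      setIntegral_union (hd ε) measurableSet_Ioi (haI π i ε)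
        ((hint i).mono_set (Ioi_subset_Ioi hε.le)), ← (htailint _ ε hε).2]
    congr 1
    refine integral_congr_ae (Eventually.of_forall fun s => ?_)
    simp only [← contTrans_add, add_sub_cancel, a]
  have hvalc : ∀ ε, 0 < ε → contValueConcat q r ε π' π i =
      (∫ s in Ioc 0 ε, a π' i s) + ∑ m, contTrans q π' ε i m * W ε m := by
    intro ε hε
    -- The interval is open because at `s = ε` the control has already switched; the endpoint is a
    -- null set.
    have e1 : EqOn (a π' i)
        (fun s => ∑ j, concatTrans q ε π' π s i j * r s (concatAt ε π' π s) j) (Ioo 0 ε) :=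
      fun s hs => by simp only [a, concatTrans, concatAt, if_pos hs.2]
    have e2 : EqOn (fun s => ∑ l, (contTrans q π' ε * contTrans q π (s - ε)) i l * r s π l)
        (fun s => ∑ j, concatTrans q ε π' π s i j * r s (concatAt ε π' π s) j) (Ioi ε) :=
      fun s hs => by simp only [concatTrans, concatAt, if_neg (not_lt.2 (le_of_lt (mem_Ioi.1 hs)))]
    obtain ⟨t1, t2⟩ := htailint (contTrans q π' ε) ε hε
    rw [contValueConcat, ← Ioc_union_Ioi_eq_Ioi hε.le,
      setIntegral_union (hd ε) measurableSet_Ioi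
        ((integrableOn_Ioc_iff_integrableOn_Ioo (by simp)).2
          (((haI π' i ε).mono_set Ioo_subset_Ioc_self).congr_fun e1 measurableSet_Ioo))
        (t1.congr_fun e2 measurableSet_Ioi), ← t2, integral_Ioc_eq_integral_Ioo,
      integral_Ioc_eq_integral_Ioo, setIntegral_congr_fun measurableSet_Ioo e1,
      setIntegral_congr_fun measurableSet_Ioi e2]
  have hW : ∀ m, Tendsto (fun ε => W ε m) (𝓝[>] 0) (𝓝 (contValue q r π m)) := by
    intro m
    have hI : ∀ l, Tendsto (fun ε => ∫ s in Ioi ε, a π l s) (𝓝[>] 0)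
        (𝓝 (contValue q r π l)) := by
      intro l
      have h2 : Tendsto (fun ε : ℝ => ε * (ε⁻¹ * ∫ s in Ioc 0 ε, a π l s)) (𝓝[>] 0) (𝓝 0) := by
        simpa using (tendsto_nhdsWithin_of_tendsto_nhds (tendsto_id (x := 𝓝 (0 : ℝ)))).mul
          (tendsto_average_integral (ha π l))
      have h3 := (tendsto_const_nhds (x := contValue q r π l)).sub h2
      rw [sub_zero] at h3
      refine h3.congr' ?_
      filter_upwards [self_mem_nhdsWithin] with ε hε
      have hε' : ε ≠ 0 := ne_of_gt hε
      rw [← mul_assoc, mul_inv_cancel₀ hε', one_mul, contValue,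
        ← Ioc_union_Ioi_eq_Ioi (le_of_lt hε),
        setIntegral_union (hd ε) measurableSet_Ioi (haI π l ε)
          ((hint l).mono_set (Ioi_subset_Ioi (le_of_lt hε)))]
      simp [a]
    have h1 : ∀ l, Tendsto (fun ε => contTrans q π (-ε) m l) (𝓝[>] 0)
        (𝓝 ((1 : Matrix (Fin d) (Fin d) ℝ) m l)) := fun l => by
      have h2 := ((continuous_contTrans_apply q π m l).comp continuous_neg).tendsto 0
      simp only [Function.comp_def, neg_zero, contTrans_zero] at h2
      exact tendsto_nhdsWithin_of_tendsto_nhds h2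
    have h2 := tendsto_finsetSum Finset.univ fun l _ => (h1 l).mul (hI l)
    simpa [Matrix.one_apply] using h2
  -- The quotient splits into averages of the rewards over `(0, ε]` and slopes of the transition
  -- matrices applied to `W`; the identity matrices in the two slopes cancel.
  have hlim : Tendsto (fun ε : ℝ => (contValueConcat q r ε π' π i - contValue q r π i) / ε)
      (𝓝[>] 0) (𝓝 ((r 0 π' i - r 0 π i)
        + ∑ j, (avgMatrix q π' i j - avgMatrix q π i j) * contValue q r π j)) := by
    have h1 := ((tendsto_average_integral (ha π' i)).sub (tendsto_average_integral (ha π i))).add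
      (tendsto_finsetSum Finset.univ fun m _ => ((tendsto_contTrans_slope q π' i m).sub
        (tendsto_contTrans_slope q π i m)).mul (hW m))
    rw [ha0, ha0] at h1
    refine h1.congr' ?_
    filter_upwards [self_mem_nhdsWithin] with ε hε
    rw [hval ε hε, hvalc ε hε, div_eq_inv_mul, add_sub_add_comm, mul_add, mul_sub,
      ← Finset.sum_sub_distrib, Finset.mul_sum]
    congr 1
    exact Finset.sum_congr rfl fun m _ => by ring
  have hlim' := (continuous_coe_real_ereal.tendsto _).comp hlim
  refine (hlim'.limsup_eq).trans_le ?_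
  have h1 := hmax π' hπ' i
  simp only [sub_mul, Finset.sum_sub_distrib]
  exact_mod_cast (by linarith)

end ContinuousTime

/-! ### The one-step optimality of discrete equilibria -/

section DiscreteTime

variable {d ℓ : ℕ} {U : Set (EuclideanSpace ℝ (Fin ℓ))}
  {f : ℝ → Fin d → U → ℝ} {q : U → Matrix (Fin d) (Fin d) ℝ} {δ : ℝ → ℝ}

theorem discLaw_concatOne_succ (p : U → Matrix (Fin d) (Fin d) ℝ) (π' π : Control d U) (i : Fin d)
    (k : ℕ) : discLaw p (concatOne π' π) i (k + 1) =
      Matrix.vecMul (avgMatrix p π' i) (avgMatrix p π ^ k) := by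
  induction k with
  | zero => simp [discLaw, concatOne, Matrix.row]
  | succ k ih => rw [discLaw, ih, concatOne, Matrix.vecMul_vecMul, ← pow_succ]

theorem concatOne_self (π : Control d U) : concatOne π π = fun _ => π := by
  funext k
  cases k <;> rfl

theorem avgRewardEnt_step (h lam : ℝ) (k : ℕ) (π : Control d U) (i : Fin d) :
    avgRewardEnt (stepReward h f) (stepDiscount h δ) (h * lam) k π i =
      h * avgRewardEnt f δ lam (k * h) π i := by
  simp only [avgRewardEnt, avgReward, stepReward, stepDiscount, integral_mul_const]
  ring

/-- Dynamic programming over one step: after time `0` the deviation matters only through the law at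
time `h`. Summability justifies splitting off the first term and exchanging the sums. -/
theorem discValue_concatOne [CompactSpace U] (hLip : UniformLipschitz f q) {h lam : ℝ}
    {π : Control d U}
    (hsum : ∀ j, Summable (gridTerm h (avgMatrix q π) (fun t l => avgRewardEnt f δ lam t π l) j))
    (π' : Control d U) (i : Fin d) :
    discValue (stepMatrix h q) (avgRewardEnt (stepReward h f) (stepDiscount h δ) (h * lam))
        (concatOne π' π) i =
      h * avgRewardEnt f δ lam 0 π' i + ∑ j, (h • avgMatrix q π' + 1) i j *
        gridValue h (avgMatrix q π) (fun t l => avgRewardEnt f δ lam t π l) j := by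
  have hterm : ∀ k, ∑ l, discLaw (stepMatrix h q) (concatOne π' π) i (k + 1) l *
      avgRewardEnt (stepReward h f) (stepDiscount h δ) (h * lam) (k + 1)
        (concatOne π' π (k + 1)) l =
      ∑ j, (h • avgMatrix q π' + 1) i j *
        (h * gridTerm h (avgMatrix q π) (fun t l => avgRewardEnt f δ lam t π l) j k) := by
    intro k
    rw [discLaw_concatOne_succ]
    simp only [avgRewardEnt_step, avgMatrix_stepMatrix hLip, concatOne, gridTerm,
      Matrix.vecMul, dotProduct, Finset.mul_sum, Finset.sum_mul]
    rw [Finset.sum_comm]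
    exact Finset.sum_congr rfl fun _ _ => Finset.sum_congr rfl fun _ _ => by ring
  have hs : ∀ j, Summable fun k => (h • avgMatrix q π' + 1) i j *
      (h * gridTerm h (avgMatrix q π) (fun t l => avgRewardEnt f δ lam t π l) j k) := fun j =>
    ((hsum j).mul_left h).mul_left _
  rw [discValue, Summable.tsum_eq_zero_add]
  · simp only [hterm]
    rw [Summable.tsum_finsetSum fun j _ => hs j]
    congr 1
    · simp [discLaw, concatOne, avgRewardEnt_step, Pi.single_apply]
    · refine Finset.sum_congr rfl fun j _ => ?_
      rw [tsum_mul_left, tsum_mul_left, gridValue]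
  · rw [← summable_nat_add_iff 1]
    simp only [hterm]
    exact summable_sum fun j _ => hs j

/-- A discrete equilibrium maximizes, state by state, the instantaneous reward rate plus the drift
of its own continuation value. -/
theorem IsDiscEquilibrium.le [CompactSpace U] (hLip : UniformLipschitz f q) {h lam : ℝ}
    (hh : 0 < h) {A : Set (Control d U)} {π : Control d U}
    (hsum : ∀ j, Summable (gridTerm h (avgMatrix q π) (fun t l => avgRewardEnt f δ lam t π l) j))
    (heq : IsDiscEquilibrium A (stepMatrix h q)
      (avgRewardEnt (stepReward h f) (stepDiscount h δ) (h * lam)) π)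
    {π' : Control d U} (hπ' : π' ∈ A) (i : Fin d) :
    avgRewardEnt f δ lam 0 π' i + ∑ j, avgMatrix q π' i j *
        gridValue h (avgMatrix q π) (fun t l => avgRewardEnt f δ lam t π l) j ≤
      avgRewardEnt f δ lam 0 π i + ∑ j, avgMatrix q π i j *
        gridValue h (avgMatrix q π) (fun t l => avgRewardEnt f δ lam t π l) j := by
  have h1 := heq.2 i π' hπ'
  rw [← concatOne_self π, discValue_concatOne hLip hsum, discValue_concatOne hLip hsum] at h1
  -- The identity part of `h Q + 1` contributes the same term on both sides; the rest is divisible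
  -- by `h`.
  simp only [Matrix.add_apply, Matrix.smul_apply, smul_eq_mul, add_mul, Finset.sum_add_distrib,
    mul_assoc, ← Finset.mul_sum] at h1
  refine le_of_mul_le_mul_left ?_ hh
  linarith

end DiscreteTime

/-! ### Gibbs measures -/

section Gibbs

variable {ℓ : ℕ} {U : Set (EuclideanSpace ℝ (Fin ℓ))}

theorem leb_apply (hUc : IsCompact U) (s : Set U) : leb U s = volume (Subtype.val '' s) :=
  comap_subtype_coe_apply hUc.measurableSet _ _

theorem isFiniteMeasure_leb (hUc : IsCompact U) : IsFiniteMeasure (leb U) :=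
  ⟨by rw [leb_apply hUc]; simpa using hUc.measure_lt_top⟩

theorem neZero_leb (hUc : IsCompact U) (hUpos : 0 < volume U) : NeZero (leb U) :=
  ⟨fun h0 => by
    have h1 := leb_apply hUc univ
    rw [h0] at h1
    simp only [Measure.coe_zero, Pi.zero_apply, image_univ, Subtype.range_coe_subtype,
      ofPred_mem_eq] at h1
    exact hUpos.ne h1⟩

/-- The normalizing constant of the Gibbs measure with potential `g`. -/
def partition (g : U → ℝ) : ℝ := ∫ u, Real.exp (g u) ∂(leb U)

/-- The density of the Gibbs measure with potential `g`. -/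
def gibbsDensity (g : U → ℝ) (u : U) : ℝ := Real.exp (g u) / partition g

theorem IsDensityOf.entropy_eq [IsFiniteMeasure (leb U)] {μ : ProbabilityMeasure U} {ρ : U → ℝ}
    (h : IsDensityOf μ ρ) : entropy μ = densityEntropy ρ := by
  have h1 := Measure.rnDeriv_withDensity (leb U) h.1.ennreal_ofReal
  rw [← h.2.2] at h1
  rw [entropy, densityEntropy, densityEntropy]
  congr 1
  refine integral_congr_ae ?_
  filter_upwards [h1] with u hu
  rw [hu, ENNReal.toReal_ofReal (h.2.1 u)]

theorem IsDensityOf.integral_eq {μ : ProbabilityMeasure U} {ρ : U → ℝ} (h : IsDensityOf μ ρ)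
    (φ : U → ℝ) : ∫ u, φ u ∂(μ : Measure U) = ∫ u, ρ u * φ u ∂(leb U) := by
  rw [h.2.2, integral_withDensity_eq_integral_toReal_smul h.1.ennreal_ofReal (by simp)]
  exact integral_congr_ae (Eventually.of_forall fun u => by
    simp only [ENNReal.toReal_ofReal (h.2.1 u), smul_eq_mul])

theorem IsDensityOf.integrable_mul {μ : ProbabilityMeasure U} {ρ : U → ℝ} (h : IsDensityOf μ ρ)
    {φ : U → ℝ} (hφ : Integrable φ (μ : Measure U)) : Integrable (fun u => ρ u * φ u) (leb U) := by
  rw [h.2.2, integrable_withDensity_iff_integrable_smul' h.1.ennreal_ofReal (by simp)] at hφ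
  refine hφ.congr (Eventually.of_forall fun u => ?_)
  simp only [ENNReal.toReal_ofReal (h.2.1 u), smul_eq_mul]

theorem continuous_gibbsDensity {g : U → ℝ} (hg : Continuous g) : Continuous (gibbsDensity g) :=
  (Real.continuous_exp.comp hg).div_const _

theorem IsDensityOf.integral_one {μ : ProbabilityMeasure U} {ρ : U → ℝ} (h : IsDensityOf μ ρ) :
    Integrable ρ (leb U) ∧ ∫ u, ρ u ∂(leb U) = 1 := by
  have h1 := h.integrable_mul (integrable_const (1 : ℝ))
  have h2 := h.integral_eq fun _ => 1
  simp only [mul_one] at h1 h2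
  exact ⟨h1, by rw [← h2]; simp⟩

variable [CompactSpace U] [IsFiniteMeasure (leb U)]

theorem continuous_integral_leb {X : Type*} [TopologicalSpace X]
    [FirstCountableTopology X] [LocallyCompactSpace X] {F : X → U → ℝ} (hF : Continuous (Function.uncurry F)) :
    Continuous fun x => ∫ u, F x u ∂(leb U) := by
  have h1 := continuous_parametric_integral_of_continuous (μ := leb U) hF isCompact_univ
  simpa using h1

theorem continuous_partition {X : Type*} [TopologicalSpace X] [FirstCountableTopology X]
    [LocallyCompactSpace X] {g : X → U → ℝ} (hg : Continuous (Function.uncurry g)) :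
    Continuous fun x => partition (g x) :=
  continuous_integral_leb (F := fun x u => Real.exp (g x u)) (Real.continuous_exp.comp hg)

variable [NeZero (leb U)]

theorem partition_pos {g : U → ℝ} (hg : Continuous g) : 0 < partition g :=
  integral_exp_pos (integrable_of_continuous (Real.continuous_exp.comp hg) _)

theorem gibbsDensity_pos {g : U → ℝ} (hg : Continuous g) (u : U) : 0 < gibbsDensity g u :=
  div_pos (Real.exp_pos _) (partition_pos hg)

theorem integral_gibbsDensity {g : U → ℝ} (hg : Continuous g) :
    ∫ u, gibbsDensity g u ∂(leb U) = 1 := by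
  simp only [gibbsDensity]
  rw [integral_div]
  exact div_self (partition_pos hg).ne'

theorem log_gibbsDensity {g : U → ℝ} (hg : Continuous g) (u : U) :
    Real.log (gibbsDensity g u) = g u - Real.log (partition g) := by
  rw [gibbsDensity, Real.log_div (Real.exp_pos _).ne' (partition_pos hg).ne', Real.log_exp]

theorem exists_isDensityOf_gibbsDensity {g : U → ℝ} (hg : Continuous g) :
    ∃ μ : ProbabilityMeasure U, IsDensityOf μ (gibbsDensity g) := by
  refine ⟨⟨(leb U).withDensity fun u => ENNReal.ofReal (gibbsDensity g u), ⟨?_⟩⟩,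
    (continuous_gibbsDensity hg).measurable, fun u => (gibbsDensity_pos hg u).le, rfl⟩
  rw [withDensity_apply _ MeasurableSet.univ, Measure.restrict_univ,
    ← ofReal_integral_eq_lintegral_ofReal
      (integrable_of_continuous (continuous_gibbsDensity hg) _)
      (Eventually.of_forall fun u => (gibbsDensity_pos hg u).le),
    integral_gibbsDensity hg, ENNReal.ofReal_one]

theorem integrable_log_gibbsDensity_mul {g : U → ℝ} (hg : Continuous g) :
    Integrable (fun u => Real.log (gibbsDensity g u) * gibbsDensity g u) (leb U) := by
  simp only [log_gibbsDensity hg]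
  exact integrable_of_continuous ((hg.sub continuous_const).mul (continuous_gibbsDensity hg)) _

/-- Gibbs' variational principle: the free energy gap is a relative entropy. -/
theorem IsDensityOf.free_energy {μ : ProbabilityMeasure U} {ρ : U → ℝ} (h : IsDensityOf μ ρ)
    (hρ : Integrable (fun u => Real.log (ρ u) * ρ u) (leb U)) {g : U → ℝ} (hg : Continuous g) :
    let D := fun u => gibbsDensity g u * InformationTheory.klFun (ρ u / gibbsDensity g u)
    Integrable D (leb U) ∧ 0 ≤ D ∧
      ∫ u, D u ∂(leb U) = Real.log (partition g) - (∫ u, g u ∂(μ : Measure U) + entropy μ) := by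
  intro D
  -- The last two terms integrate to zero, as both densities have mass one, but they make the
  -- integrand nonnegative pointwise. Where `ρ` vanishes, both sides equal the Gibbs density.
  have hD : ∀ u, D u = Real.log (ρ u) * ρ u - ρ u * g u + Real.log (partition g) * ρ u
      + gibbsDensity g u - ρ u := by
    intro u
    have hp := gibbsDensity_pos hg u
    simp only [D, InformationTheory.klFun_apply]
    rcases (h.2.1 u).eq_or_lt with h0 | h0
    · simp [← h0]
    · rw [Real.log_div h0.ne' hp.ne', log_gibbsDensity hg]
      field_simp
      ring
  have i1 := h.integrable_mul (integrable_of_continuous hg (μ : Measure U))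
  obtain ⟨i2, i3⟩ := h.integral_one
  have i4 := integrable_of_continuous (continuous_gibbsDensity hg) (leb U)
  have j1 : Integrable (fun u => Real.log (ρ u) * ρ u - ρ u * g u) (leb U) := hρ.sub i1
  have j2 : Integrable (fun u => Real.log (ρ u) * ρ u - ρ u * g u
      + Real.log (partition g) * ρ u) (leb U) := j1.add (i2.const_mul _)
  have j3 : Integrable (fun u => Real.log (ρ u) * ρ u - ρ u * g u
      + Real.log (partition g) * ρ u + gibbsDensity g u) (leb U) := j2.add i4
  have hDf : D = fun u => Real.log (ρ u) * ρ u - ρ u * g u + Real.log (partition g) * ρ u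
      + gibbsDensity g u - ρ u := funext hD
  refine ⟨by rw [hDf]; exact j3.sub i2, fun u => mul_nonneg (gibbsDensity_pos hg u).le
    (InformationTheory.klFun_nonneg (div_nonneg (h.2.1 u) (gibbsDensity_pos hg u).le)), ?_⟩
  simp only [hDf]
  rw [integral_sub j3 i2, integral_add j2 i4,
    integral_add j1 (i2.const_mul (Real.log (partition g))), integral_sub hρ i1,
    integral_const_mul, i3, integral_gibbsDensity hg, h.integral_eq g, h.entropy_eq, densityEntropy]
  ring

theorem IsDensityOf.free_energy_le {μ : ProbabilityMeasure U} {ρ : U → ℝ} (h : IsDensityOf μ ρ)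
    (hρ : Integrable (fun u => Real.log (ρ u) * ρ u) (leb U)) {g : U → ℝ} (hg : Continuous g) :
    ∫ u, g u ∂(μ : Measure U) + entropy μ ≤ Real.log (partition g) := by
  obtain ⟨-, h2, h3⟩ := h.free_energy hρ hg
  have h4 := integral_nonneg (μ := leb U) h2
  linarith

/-- Equality case of the variational principle: the relative entropy is zero, so its nonnegative
integrand vanishes almost everywhere, and `klFun` vanishes only at `1`. -/
theorem IsDensityOf.gibbs_of_le {μ : ProbabilityMeasure U} {ρ : U → ℝ} (h : IsDensityOf μ ρ)
    (hρ : Integrable (fun u => Real.log (ρ u) * ρ u) (leb U)) {g : U → ℝ} (hg : Continuous g)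
    (hle : Real.log (partition g) ≤ ∫ u, g u ∂(μ : Measure U) + entropy μ) :
    IsDensityOf μ (gibbsDensity g) := by
  obtain ⟨h1, h2, h3⟩ := h.free_energy hρ hg
  have h4 : ∫ u, gibbsDensity g u * InformationTheory.klFun (ρ u / gibbsDensity g u) ∂(leb U) = 0 := by
    have h0 := integral_nonneg (μ := leb U) h2
    exact le_antisymm (by linarith) h0
  rw [integral_eq_zero_iff_of_nonneg h2 h1] at h4
  refine ⟨(continuous_gibbsDensity hg).measurable, fun u => (gibbsDensity_pos hg u).le, ?_⟩
  rw [h.2.2]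
  refine withDensity_congr_ae ?_
  filter_upwards [h4] with u hu
  have hp := gibbsDensity_pos hg u
  have h5 := (mul_eq_zero.1 hu).resolve_left hp.ne'
  rw [InformationTheory.klFun_eq_zero_iff (div_nonneg (h.2.1 u) hp.le), div_eq_one_iff_eq hp.ne']
    at h5
  rw [h5]

theorem IsDensityOf.entropy_gibbs {μ : ProbabilityMeasure U} {g : U → ℝ} (hg : Continuous g)
    (h : IsDensityOf μ (gibbsDensity g)) :
    ∫ u, g u ∂(μ : Measure U) + entropy μ = Real.log (partition g) := by
  obtain ⟨-, -, h3⟩ := h.free_energy (integrable_log_gibbsDensity_mul hg) hg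
  have h4 : ∀ u, gibbsDensity g u * InformationTheory.klFun (gibbsDensity g u / gibbsDensity g u)
      = 0 := fun u => by rw [div_self (gibbsDensity_pos hg u).ne']; simp [InformationTheory.klFun_one]
  simp only [h4, integral_zero] at h3
  linarith

/-- The variational principle with zero potential bounds the entropy by the logarithm of the volume
of `U`. -/
theorem exists_entropy_le : ∃ K : ℝ, ∀ (μ : ProbabilityMeasure U) (ρ : U → ℝ), IsDensityOf μ ρ →
    Integrable (fun u => Real.log (ρ u) * ρ u) (leb U) → entropy μ ≤ K := by
  refine ⟨Real.log (partition fun _ : U => 0), fun μ ρ h hρ => ?_⟩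
  simpa using h.free_energy_le hρ (continuous_const (y := (0 : ℝ)))

/-! ### Continuous dependence of Gibbs measures on the potential -/

section Parametric

variable {X : Type*} [TopologicalSpace X] [FirstCountableTopology X] [LocallyCompactSpace X]
  {g : X → U → ℝ}

theorem continuous_gibbsDensity_apply (hg : Continuous (Function.uncurry g)) (u : U) :
    Continuous fun x => gibbsDensity (g x) u :=
  (Real.continuous_exp.comp (hg.comp (Continuous.prodMk_left u))).div (continuous_partition hg)
    fun x => (partition_pos (hg.comp (Continuous.prodMk_right x))).ne'

theorem continuous_integral_gibbs (hg : Continuous (Function.uncurry g))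
    {μ : X → ProbabilityMeasure U} (hμ : ∀ x, IsDensityOf (μ x) (gibbsDensity (g x)))
    {φ : X → U → ℝ} (hφ : Continuous (Function.uncurry φ)) :
    Continuous fun x => ∫ u, φ x u ∂(μ x : Measure U) := by
  have h1 : ∀ x, ∫ u, φ x u ∂(μ x : Measure U)
      = (∫ u, Real.exp (g x u) * φ x u ∂(leb U)) / partition (g x) := by
    intro x
    rw [(hμ x).integral_eq, ← integral_div]
    exact integral_congr_ae (Eventually.of_forall fun u => by
      simp only [gibbsDensity]; ring)
  simp only [h1]
  refine Continuous.div ?_ (continuous_partition hg)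
    fun x => (partition_pos (hg.comp (Continuous.prodMk_right x))).ne'
  exact continuous_integral_leb (F := fun x u => Real.exp (g x u) * φ x u)
    ((Real.continuous_exp.comp hg).mul hφ)

theorem continuous_gibbs (hg : Continuous (Function.uncurry g))
    {μ : X → ProbabilityMeasure U} (hμ : ∀ x, IsDensityOf (μ x) (gibbsDensity (g x))) :
    Continuous μ := by
  refine continuous_iff_continuousAt.2 fun x =>
    ProbabilityMeasure.tendsto_iff_forall_integral_tendsto.2 fun φ => ?_
  exact (continuous_integral_gibbs hg hμ (φ := fun _ u => φ u)
    (φ.continuous.comp continuous_snd)).tendsto x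

/-- Within a Gibbs family the entropy is `log Z - ∫ g dμ`, and both terms are continuous in the
parameter; weak convergence alone would not give this. -/
theorem continuous_entropy_gibbs (hg : Continuous (Function.uncurry g))
    {μ : X → ProbabilityMeasure U} (hμ : ∀ x, IsDensityOf (μ x) (gibbsDensity (g x))) :
    Continuous fun x => entropy (μ x) := by
  have h1 : ∀ x, entropy (μ x) = Real.log (partition (g x)) - ∫ u, g x u ∂(μ x : Measure U) :=
    fun x => by linarith [(hμ x).entropy_gibbs (g := g x) (hg.comp (Continuous.prodMk_right x))]
  simp only [h1]
  exact ((continuous_partition hg).log fun x =>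
    (partition_pos (hg.comp (Continuous.prodMk_right x))).ne').sub
      (continuous_integral_gibbs hg hμ hg)

end Parametric

end Gibbs

/-! ### Entropy of Gibbs measures under the uniform cone condition -/

section Cone

variable {ℓ : ℕ} {U : Set (EuclideanSpace ℝ (Fin ℓ))}

/-- For `v` in the ball, `v - u` is shorter than `s (1 + κ)` and has component at least `s (1 - κ)`
along the axis, so `hι` is exactly the angle condition. -/
theorem ball_subset_circularCone {u e : EuclideanSpace ℝ (Fin ℓ)} (he : ‖e‖ = 1) {ι κ s : ℝ}
    (hκ : κ ≤ 1) (hs : 0 ≤ s) (hι0 : 0 ≤ Real.cos ι) (hι : Real.cos ι * (1 + κ) ≤ 1 - κ) :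
    Metric.ball (u + s • e) (s * κ) ⊆ circularCone u e ι ∩ Metric.ball u (2 * s) := by
  intro v hv
  rw [Metric.mem_ball, dist_eq_norm] at hv
  set w := v - (u + s • e) with hw
  have hvu : v - u = s • e + w := by rw [hw]; abel
  have hse : ‖s • e‖ = s := by rw [norm_smul, he, mul_one, Real.norm_of_nonneg hs]
  have h1 : ‖v - u‖ < s * (1 + κ) := by
    rw [hvu]
    calc ‖s • e + w‖ ≤ ‖s • e‖ + ‖w‖ := norm_add_le _ _
      _ < s * (1 + κ) := by rw [hse]; linarith
  have h2 : s * (1 - κ) ≤ inner ℝ e (v - u) := by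
    have h3 : |inner ℝ e w| ≤ ‖w‖ := by simpa [he] using abs_real_inner_le_norm e w
    rw [hvu, inner_add_right, inner_smul_right, real_inner_self_eq_norm_sq, he]
    have := (abs_le.1 h3).1
    linarith
  refine ⟨?_, ?_⟩
  · calc Real.cos ι * ‖v - u‖ ≤ Real.cos ι * (s * (1 + κ)) := by gcongr
      _ = s * (Real.cos ι * (1 + κ)) := by ring
      _ ≤ s * (1 - κ) := by gcongr
      _ ≤ _ := h2
  · rw [Metric.mem_ball, dist_eq_norm]
    nlinarith

/-- Under the cone condition every point of `U` has, at every small scale, a ball of comparable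
radius and distance inside `U`. -/
theorem UniformCone.exists_ball (hU : UniformCone U) :
    ∃ σ > 0, ∃ κ > 0, ∀ u ∈ U, ∀ s, 0 ≤ s → s ≤ σ →
      ∃ c, Metric.ball c (s * κ) ⊆ U ∩ Metric.ball u (2 * s) := by
  obtain ⟨ϑ, hϑ, ι, ⟨hι0, hι1⟩, h⟩ := hU
  have hc0 : 0 ≤ Real.cos ι := Real.cos_nonneg_of_mem_Icc ⟨by linarith [Real.pi_pos], hι1⟩
  have hc1 : Real.cos ι < 1 := by
    rw [← Real.cos_zero]
    exact Real.cos_lt_cos_of_nonneg_of_le_pi le_rfl (by linarith [Real.pi_pos]) hι0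
  have hκ : (1 - Real.cos ι) / (1 + Real.cos ι) ≤ 1 := by
    rw [div_le_one (by linarith)]; linarith
  -- This `κ` solves `cos ι (1 + κ) = 1 - κ` and is positive as `ι > 0`; `s ≤ ϑ / 2` keeps the ball
  -- of radius `2 s` within reach of the cone condition.
  refine ⟨ϑ / 2, by positivity, (1 - Real.cos ι) / (1 + Real.cos ι),
    div_pos (by linarith) (by linarith), fun u hu s hs hsσ => ?_⟩
  obtain ⟨e, he, hsub⟩ := h u hu
  have h1 := ball_subset_circularCone (u := u) he hκ hs hc0 (ι := ι) (by
    have : 1 + Real.cos ι ≠ 0 := by positivity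
    apply le_of_eq
    field_simp
    ring)
  refine ⟨u + s • e, fun v hv => ⟨hsub ⟨(h1 hv).1, ?_⟩, (h1 hv).2⟩⟩
  exact Metric.ball_subset_ball (by linarith) (h1 hv).2

variable [CompactSpace U] [IsFiniteMeasure (leb U)] [NeZero (leb U)]

/-- At the scale `s = σ / (1 + L)` the potential drops by at most `2 σ` within distance `2 s` of
`u`, and `U` contains there a ball of radius `s κ`. This bounds the partition function below by a
multiple of `exp (g u) (1 + L)^(-ℓ)`. -/
theorem UniformCone.exists_gibbsDensity_le (hU : UniformCone U) (hUc : IsCompact U) :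
    ∃ K > 0, ∀ L : ℝ, 0 ≤ L → ∀ g : U → ℝ, (∀ u v, |g u - g v| ≤ L * dist u v) →
      Continuous g → ∀ u, gibbsDensity g u ≤ K * (1 + L) ^ ℓ := by
  obtain ⟨σ, hσ, κ, hκ, hball⟩ := hU.exists_ball
  set b := volume.real (Metric.ball (0 : EuclideanSpace ℝ (Fin ℓ)) 1) with hb
  have hb0 : 0 < b := ENNReal.toReal_pos (Metric.measure_ball_pos _ _ one_pos).ne'
    measure_ball_lt_top.ne
  refine ⟨Real.exp (2 * σ) / ((σ * κ) ^ ℓ * b), by positivity, fun L hL g hg hgc u => ?_⟩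
  set s := σ / (1 + L) with hs
  have hs0 : 0 < s := by positivity
  have hsσ : s ≤ σ := div_le_self hσ.le (by linarith)
  obtain ⟨c, hc⟩ := hball u u.2 s hs0.le hsσ
  have hvol : (leb U).real (Subtype.val ⁻¹' Metric.ball c (s * κ)) = (s * κ) ^ ℓ * b := by
    rw [measureReal_def, leb_apply hUc, Subtype.image_preimage_coe,
      inter_eq_self_of_subset_right (fun v hv => (hc hv).1),
      Measure.addHaar_ball_of_pos _ _ (by positivity), ENNReal.toReal_mul,
      ENNReal.toReal_ofReal (by positivity), finrank_euclideanSpace_fin]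
    rfl
  have hmeas : MeasurableSet (Subtype.val ⁻¹' Metric.ball c (s * κ) : Set U) :=
    measurable_subtype_coe Metric.isOpen_ball.measurableSet
  have hexp := integrable_of_continuous (Real.continuous_exp.comp hgc) (leb U)
  have hZ : Real.exp (g u - 2 * σ) * ((s * κ) ^ ℓ * b) ≤ partition g := by
    calc Real.exp (g u - 2 * σ) * ((s * κ) ^ ℓ * b)
        = ∫ _ in Subtype.val ⁻¹' Metric.ball c (s * κ), Real.exp (g u - 2 * σ) ∂(leb U) := by
          rw [setIntegral_const, hvol, smul_eq_mul, mul_comm]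
      _ ≤ ∫ v in Subtype.val ⁻¹' Metric.ball c (s * κ), Real.exp (g v) ∂(leb U) := by
          refine setIntegral_mono_on (integrable_const _) hexp.integrableOn hmeas fun v hv => ?_
          have h1 := (hc hv).2
          rw [Metric.mem_ball] at h1
          have h2 := hg u v
          have h3 : L * dist u v ≤ 2 * σ := by
            have h4 : dist u v ≤ 2 * s := by rw [dist_comm]; exact h1.le
            calc L * dist u v ≤ L * (2 * s) := by gcongr
              _ = 2 * σ * (L / (1 + L)) := by rw [hs]; ring
              _ ≤ 2 * σ * 1 := by gcongr; rw [div_le_one (by positivity)]; linarith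
              _ = 2 * σ := mul_one _
          exact Real.exp_le_exp.2 (by linarith [(abs_le.1 h2).2])
      _ ≤ partition g := setIntegral_le_integral hexp
          (Eventually.of_forall fun v => (Real.exp_pos _).le)
  rw [gibbsDensity, div_le_iff₀ (partition_pos hgc)]
  refine le_trans (le_of_eq ?_) (mul_le_mul_of_nonneg_left hZ (by positivity))
  rw [hs, Real.exp_sub, div_mul_eq_mul_div σ (1 + L) κ, div_pow]
  field_simp

/-- The entropy of a Gibbs measure deteriorates at most logarithmically in the Lipschitz constant
of its potential. -/
theorem UniformCone.exists_le_entropy (hU : UniformCone U) (hUc : IsCompact U) :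
    ∃ K : ℝ, ∀ L : ℝ, 0 ≤ L → ∀ g : U → ℝ, (∀ u v, |g u - g v| ≤ L * dist u v) →
      Continuous g → ∀ μ : ProbabilityMeasure U, IsDensityOf μ (gibbsDensity g) →
        -(K + ℓ * Real.log (1 + L)) ≤ entropy μ := by
  obtain ⟨K, hK, h⟩ := hU.exists_gibbsDensity_le hUc
  refine ⟨Real.log K, fun L hL g hg hgc μ hμ => ?_⟩
  rw [hμ.entropy_eq, densityEntropy, neg_le_neg_iff]
  have h1 : ∀ u, Real.log (gibbsDensity g u) ≤ Real.log K + ℓ * Real.log (1 + L) := by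
    intro u
    rw [← Real.log_pow, ← Real.log_mul hK.ne' (by positivity)]
    exact Real.log_le_log (gibbsDensity_pos hgc u) (h L hL g hg hgc u)
  have hi := integrable_of_continuous (continuous_gibbsDensity hgc) (leb U)
  calc ∫ u, Real.log (gibbsDensity g u) * gibbsDensity g u ∂(leb U)
      ≤ ∫ u, (Real.log K + ℓ * Real.log (1 + L)) * gibbsDensity g u ∂(leb U) :=
        integral_mono (integrable_log_gibbsDensity_mul hgc) (hi.const_mul _) fun u =>
          mul_le_mul_of_nonneg_right (h1 u) (gibbsDensity_pos hgc u).le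
    _ = Real.log K + ℓ * Real.log (1 + L) := by
        rw [integral_const_mul, integral_gibbsDensity hgc, mul_one]

end Cone

/-! ### Convergence of discrete equilibria -/

/-- The tangent bound `log y ≤ t y - 1 - log t` holds for every `t > 0`; this `t` makes the slope in
`x` at most `1 / 2`, so that term is absorbed on the left. -/
theorem exists_bound_of_le_add_mul_log {a b c e : ℝ} (hb : 0 ≤ b) (hc : 0 ≤ c)
    (he : 0 ≤ e) : ∃ R, ∀ x, 0 ≤ x → x ≤ a + b * Real.log (1 + c * (1 + e * x)) → x ≤ R := by
  set t : ℝ := 1 / (2 * (b * c * e + 1)) with ht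
  have ht0 : 0 < t := by positivity
  refine ⟨2 * (a + b * ((1 + c) * t - 1 - Real.log t)), fun x hx h => ?_⟩
  have hy : 0 < 1 + c * (1 + e * x) := by positivity
  have h1 := Real.log_le_sub_one_of_pos (mul_pos hy ht0)
  rw [Real.log_mul hy.ne' ht0.ne'] at h1
  have h2 : b * Real.log (1 + c * (1 + e * x))
      ≤ b * ((1 + c * (1 + e * x)) * t - 1 - Real.log t) := by
    gcongr; linarith
  have h3 : b * c * e * t ≤ 1 / 2 := by
    rw [ht, mul_one_div, div_le_div_iff₀ (by positivity) (by norm_num)]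
    linarith
  have h4 : b * c * e * t * x ≤ 1 / 2 * x := by gcongr
  nlinarith

section Main

variable {d ℓ : ℕ} {U : Set (EuclideanSpace ℝ (Fin ℓ))}
  {f : ℝ → Fin d → U → ℝ} {q : U → Matrix (Fin d) (Fin d) ℝ} {δ : ℝ → ℝ}

/-- The potential of the Gibbs measure that is optimal in state `i` for the continuation
values `V`. -/
def potential (f : ℝ → Fin d → U → ℝ) (q : U → Matrix (Fin d) (Fin d) ℝ) (lam : ℝ) (i : Fin d)
    (V : Fin d → ℝ) (u : U) : ℝ :=
  lam⁻¹ * (f 0 i u + ∑ j, q u i j * V j)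

theorem continuous_potential (hLip : UniformLipschitz f q)
    (hfcont : ∀ i u, ContinuousOn (fun t => f t i u) (Ici 0)) (lam : ℝ) (i : Fin d) :
    Continuous (Function.uncurry (potential f q lam i)) := by
  have h1 := hLip.continuous_reward_action hfcont i le_rfl
  have h2 := hLip.continuous_rate i
  refine continuous_const.mul ((h1.comp continuous_snd).add
    (continuous_finsetSum _ fun j _ => ((h2 j).comp continuous_snd).mul ?_))
  exact (continuous_apply j).comp continuous_fst

theorem exists_potential_lipschitz (hLip : UniformLipschitz f q) {lam : ℝ} (hlam : 0 < lam) :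
    ∃ c : ℝ, 0 ≤ c ∧ ∀ i V u v,
      |potential f q lam i V u - potential f q lam i V v| ≤ c * (1 + d * ‖V‖) * dist u v := by
  obtain ⟨Θ, hΘ, hf, hq⟩ := hLip.exists_nonneg
  refine ⟨lam⁻¹ * Θ, by positivity, fun i V u v => ?_⟩
  have h1 : potential f q lam i V u - potential f q lam i V v =
      lam⁻¹ * ((f 0 i u - f 0 i v) + ∑ j, (q u i j - q v i j) * V j) := by
    simp only [potential, sub_mul, Finset.sum_sub_distrib]
    ring
  have h2 : |∑ j, (q u i j - q v i j) * V j| ≤ ∑ _j : Fin d, Θ * dist u v * ‖V‖ := by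
    refine (Finset.abs_sum_le_sum_abs _ _).trans (Finset.sum_le_sum fun j _ => ?_)
    rw [abs_mul]
    exact mul_le_mul (hq i j u v) (norm_le_pi_norm V j) (abs_nonneg _) (by positivity)
  rw [h1, abs_mul, abs_of_pos (inv_pos.2 hlam), mul_assoc, mul_assoc]
  refine mul_le_mul_of_nonneg_left ?_ (inv_pos.2 hlam).le
  refine (abs_add_le _ _).trans ((add_le_add (hf 0 le_rfl i u v) h2).trans (le_of_eq ?_))
  simp only [Finset.sum_const, Finset.card_univ, Fintype.card_fin, nsmul_eq_mul]
  ring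

/-- Since `δ 0 = 1`, the entropy enters the Hamiltonian with weight exactly `lam`, so the
Hamiltonian is a multiple of the free energy in Gibbs' principle. -/
theorem avgRewardEnt_add_eq [CompactSpace U] (hLip : UniformLipschitz f q)
    (hfcont : ∀ i u, ContinuousOn (fun t => f t i u) (Ici 0)) (hδ : IsDiscount δ) {lam : ℝ}
    (hlam : lam ≠ 0) (π : Control d U) (V : Fin d → ℝ) (i : Fin d) :
    avgRewardEnt f δ lam 0 π i + ∑ j, avgMatrix q π i j * V j =
      lam * (∫ u, potential f q lam i V u ∂(π i : Measure U) + entropy (π i)) := by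
  have h1 := integrable_of_continuous (hLip.continuous_reward_action hfcont i le_rfl)
    (π i : Measure U)
  have h2 := fun j => integrable_of_continuous (hLip.continuous_rate i j) (π i : Measure U)
  simp only [potential, avgRewardEnt, avgReward, avgMatrix, Matrix.of_apply, hδ.2.2]
  rw [integral_const_mul, integral_add h1 (integrable_finsetSum _ fun j _ => (h2 j).mul_const _),
    integral_finsetSum _ fun j _ => (h2 j).mul_const _]
  simp only [integral_mul_const]
  field_simp
  ring

theorem avgReward_eq_avgRewardEnt {𝕋 : Type} (g : 𝕋 → Fin d → U → ℝ) (δ : 𝕋 → ℝ) :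
    avgReward g = avgRewardEnt g δ 0 := by
  funext t π i
  simp [avgRewardEnt]

theorem UniformTails.comp {h : ℕ → ℝ} (htail : UniformTails f h) (φ : ℕ → ℕ) :
    UniformTails f (h ∘ φ) := fun ε hε => by
  obtain ⟨T, hT⟩ := htail ε hε
  exact ⟨T, fun n => hT (φ n)⟩

variable [CompactSpace U] {h : ℕ → ℝ}

theorem tendsto_equilibria (hq : ∀ u, IsRateMatrix (q u)) (hδ : IsDiscount δ)
    (hint : IntegrableReward f δ) (hLip : UniformLipschitz f q)
    (hfcont : ∀ i u, ContinuousOn (fun t => f t i u) (Ici 0)) (hδcont : ContinuousOn δ (Ici 0))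
    (hh : ∀ n, h n ∈ Ioc (0 : ℝ) 1) (hh0 : Tendsto h atTop (𝓝 0))
    (hstoch : ∀ n u i, 0 ≤ stepMatrix (h n) q u i i) (htail : UniformTails f h)
    {π : ℕ → Control d U}
    (hπ : ∀ n, IsDiscEquilibrium univ (stepMatrix (h n) q) (avgReward (stepReward (h n) f)) (π n)) :
    ∃ (φ : ℕ → ℕ) (πlim : Control d U), StrictMono φ ∧
      (∀ i, Tendsto (fun n => π (φ n) i) atTop (𝓝 (πlim i))) ∧
      IsContEquilibrium univ q (avgReward f) πlim := by
  -- Probability measures on the compact space `U` are weakly sequentially compact, and so are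
  -- finite products of them.
  obtain ⟨πlim, φ, hφ, hlim⟩ := CompactSpace.tendsto_subseq π
  have hlimi : ∀ i, Tendsto (fun n => π (φ n) i) atTop (𝓝 (πlim i)) := tendsto_pi_nhds.1 hlim
  refine ⟨φ, πlim, hφ, hlimi, ?_⟩
  have hδint := integrableOn_discount hint hδcont
  obtain ⟨C, hC0, hC⟩ := exists_lintegral_stepTime_le hLip hfcont htail hh
  -- With `lam = 0` the required convergence of `lam * entropy` is trivial, whatever the entropies
  -- do.
  have hval := tendsto_gridValue hLip hq hfcont hδ hδcont hδint (h := h ∘ φ) (fun n => hh _)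
    (hh0.comp hφ.tendsto_atTop) (fun n => hstoch _) (htail.comp φ) (lam := 0) hlimi
    (fun i => by simp)
  rw [avgReward_eq_avgRewardEnt f δ]
  refine isContEquilibrium_of_forall_le (continuousOn_avgRewardEnt hLip hfcont hδcont 0)
    (mem_univ _) (fun j => (hval j).1) fun π' _ i => ?_
  have hle : ∀ n, _ := fun n => IsDiscEquilibrium.le (δ := δ) (lam := 0) (A := univ) hLip
    (hh (φ n)).1 (fun j => (summable_gridTerm_and_le hδ hδint (hh (φ n)).1 hC0 (hC _)
      (avgMatrix_step_mem_rowStochastic hLip hq (hh (φ n)).1 (hstoch _) (π (φ n))) le_rfl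
      (fun t ht l => enorm_avgRewardEnt_le (π := π (φ n)) hδ (by simp) ht l) j).1)
    (by
      have h1 := hπ (φ n)
      rwa [avgReward_eq_avgRewardEnt _ (stepDiscount (h (φ n)) δ),
        ← mul_zero (h (φ n))] at h1) (mem_univ π') i
  have hQ := tendsto_avgMatrix hLip hlimi
  have hr : Tendsto (fun n => avgRewardEnt f δ 0 0 (π (φ n)) i) atTop
      (𝓝 (avgRewardEnt f δ 0 0 πlim i)) := by
    simp only [← avgReward_eq_avgRewardEnt]
    exact tendsto_avgReward hLip hfcont i (hlimi i) (t := fun _ => 0) (fun _ => le_rfl) le_rfl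
      tendsto_const_nhds
  refine le_of_tendsto_of_tendsto' (tendsto_const_nhds.add (tendsto_finsetSum _ fun j _ =>
    tendsto_const_nhds.mul (hval j).2)) (hr.add (tendsto_finsetSum _ fun j _ =>
      (tendsto_pi_nhds.1 (tendsto_pi_nhds.1 hQ i) j).mul (hval j).2)) hle

variable [IsFiniteMeasure (leb U)] [NeZero (leb U)]

/-- In an entropy-regularized discrete equilibrium every state uses the Gibbs measure of its
continuation values. -/
theorem IsDiscEquilibrium.isDensityOf_gibbsDensity (hδ : IsDiscount δ)
    (hLip : UniformLipschitz f q) (hfcont : ∀ i u, ContinuousOn (fun t => f t i u) (Ici 0))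
    {h lam : ℝ} (hh : 0 < h) (hlam : 0 < lam) {π : Control d U}
    (hsum : ∀ j, Summable (gridTerm h (avgMatrix q π) (fun t l => avgRewardEnt f δ lam t π l) j))
    (heq : IsDiscEquilibrium {π | IsRegular π} (stepMatrix h q)
      (avgRewardEnt (stepReward h f) (stepDiscount h δ) (h * lam)) π) (i : Fin d) :
    IsDensityOf (π i) (gibbsDensity (potential f q lam i
      (gridValue h (avgMatrix q π) fun t l => avgRewardEnt f δ lam t π l))) := by
  set V := gridValue h (avgMatrix q π) fun t l => avgRewardEnt f δ lam t π l with hV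
  have hg := fun i => (continuous_potential hLip hfcont lam i).comp (Continuous.prodMk_right V)
  choose γ hγ using fun i => exists_isDensityOf_gibbsDensity (hg i)
  -- Deviating to the Gibbs control shows that the equilibrium attains the maximal free energy.
  have h1 := heq.le hLip hh hsum (π' := γ)
    (fun i => ⟨_, hγ i, integrable_log_gibbsDensity_mul (hg i)⟩) i
  rw [← hV, avgRewardEnt_add_eq hLip hfcont hδ hlam.ne',
    avgRewardEnt_add_eq hLip hfcont hδ hlam.ne'] at h1
  have h2 := le_of_mul_le_mul_left h1 hlam
  obtain ⟨ρ, hρ, hρi⟩ := heq.1 i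
  exact hρ.gibbs_of_le hρi (hg i) (((hγ i).entropy_gibbs (hg i)).symm.le.trans h2)

theorem tendsto_regularized_equilibria (hUc : IsCompact U) (hUcone : UniformCone U)
    (hq : ∀ u, IsRateMatrix (q u)) (hδ : IsDiscount δ)
    (hint : IntegrableReward f δ) (hLip : UniformLipschitz f q)
    (hfcont : ∀ i u, ContinuousOn (fun t => f t i u) (Ici 0)) (hδcont : ContinuousOn δ (Ici 0))
    (hh : ∀ n, h n ∈ Ioc (0 : ℝ) 1) (hh0 : Tendsto h atTop (𝓝 0))
    (hstoch : ∀ n u i, 0 ≤ stepMatrix (h n) q u i i) (htail : UniformTails f h)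
    {lam : ℝ} (hlam : 0 < lam) {π : ℕ → Control d U}
    (hπ : ∀ n, IsDiscEquilibrium {π | IsRegular π} (stepMatrix (h n) q)
        (avgRewardEnt (stepReward (h n) f) (stepDiscount (h n) δ) (h n * lam)) (π n)) :
    ∃ (φ : ℕ → ℕ) (πlim : Control d U) (ρ : ℕ → Fin d → U → ℝ) (ρlim : Fin d → U → ℝ),
      StrictMono φ ∧
      (∀ n i, IsDensityOf (π n i) (ρ n i) ∧ Continuous (ρ n i)) ∧
      (∀ i, IsDensityOf (πlim i) (ρlim i) ∧ Continuous (ρlim i)) ∧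
      (∀ i u, Tendsto (fun n => ρ (φ n) i u) atTop (𝓝 (ρlim i u))) ∧
      IsContEquilibrium {π | IsRegular π} q (avgRewardEnt f δ lam) πlim := by
  have hδint := integrableOn_discount hint hδcont
  obtain ⟨C, hC0, hC⟩ := exists_lintegral_stepTime_le hLip hfcont htail hh
  set V : ℕ → Fin d → ℝ := fun n =>
    gridValue (h n) (avgMatrix q (π n)) fun t l => avgRewardEnt f δ lam t (π n) l with hV
  have hgc := continuous_potential hLip hfcont lam
  have hgV : ∀ i V, Continuous (potential f q lam i V) := fun i V =>
    (hgc i).comp (Continuous.prodMk_right V)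
  choose γ hγ using fun i V => exists_isDensityOf_gibbsDensity (hgV i V)
  have hbound : ∀ n, ∀ E, 0 ≤ E → (∀ i, |lam * entropy (π n i)| ≤ E) → ∀ j, _ :=
    fun n E hE hEb j => summable_gridTerm_and_le hδ hδint (hh n).1 hC0 (hC n)
      (avgMatrix_step_mem_rowStochastic hLip hq (hh n).1 (hstoch n) (π n)) hE
      (fun t ht l => enorm_avgRewardEnt_le (f := f) hδ hEb ht l) j
  have hdens : ∀ n i, IsDensityOf (π n i) (gibbsDensity (potential f q lam i (V n))) := fun n =>
    (hπ n).isDensityOf_gibbsDensity hδ hLip hfcont (hh n).1 hlam fun j =>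
      -- A bound depending on `n` is enough here, since only summability is extracted.
      (hbound n (∑ i, |lam * entropy (π n i)|) (Finset.sum_nonneg fun i _ => abs_nonneg _)
        (fun i => Finset.single_le_sum (f := fun i => |lam * entropy (π n i)|)
          (fun i _ => abs_nonneg _) (Finset.mem_univ i)) j).1
  have hπγ : ∀ n i, π n i = γ i (V n) := fun n i =>
    Subtype.ext ((hdens n i).2.2.trans (hγ i (V n)).2.2.symm)
  -- a priori bound for the continuation values
  obtain ⟨R, hR⟩ : ∃ R, ∀ n, ‖V n‖ ≤ R := by
    obtain ⟨K₁, hK₁⟩ := exists_entropy_le (U := U)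
    obtain ⟨K₂, hK₂⟩ := hUcone.exists_le_entropy hUc
    obtain ⟨c, hc0, hc⟩ := exists_potential_lipschitz hLip hlam
    have hS : 0 ≤ ∫ s in Ioi 0, δ s :=
      setIntegral_nonneg measurableSet_Ioi fun s hs => (hδ.1 s (le_of_lt hs)).1
    -- The value is at most `C + E ∫ δ`, where `E` bounds `lam` times the entropies; by the cone
    -- estimate `E` can be taken affine in `log (1 + c (1 + d ‖V n‖))`.
    obtain ⟨R, hR⟩ := exists_bound_of_le_add_mul_log
      (a := C + lam * (|K₁| + |K₂|) * ∫ s in Ioi 0, δ s) (b := lam * ℓ * ∫ s in Ioi 0, δ s)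
      (c := c) (e := d) (by positivity) hc0 (by positivity)
    refine ⟨R, fun n => hR _ (norm_nonneg _) ?_⟩
    have hlog : 0 ≤ Real.log (1 + c * (1 + d * ‖V n‖)) :=
      Real.log_nonneg (le_add_of_nonneg_right (by positivity))
    have hent : ∀ i, |lam * entropy (π n i)| ≤
        lam * (|K₁| + |K₂| + ℓ * Real.log (1 + c * (1 + d * ‖V n‖))) := fun i => by
      rw [abs_mul, abs_of_pos hlam]
      refine mul_le_mul_of_nonneg_left (abs_le.2 ⟨?_, ?_⟩) hlam.le
      · have h1 := hK₂ _ (by positivity) _ (hc i (V n)) (hgV i (V n)) _ (hdens n i)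
        linarith [le_abs_self K₂, abs_nonneg K₁]
      · have h1 := hK₁ _ _ (hdens n i) (integrable_log_gibbsDensity_mul (hgV i (V n)))
        have h2 : 0 ≤ ℓ * Real.log (1 + c * (1 + d * ‖V n‖)) := by positivity
        linarith [le_abs_self K₁, abs_nonneg K₂]
    refine (pi_norm_le_iff_of_nonneg (by positivity)).2 fun j => ?_
    refine ((hbound n _ (by positivity) hent j).2).trans (le_of_eq ?_)
    ring
  obtain ⟨V₀, -, φ, hφ, hV₀⟩ := tendsto_subseq_of_bounded (x := V)
    (Metric.isBounded_closedBall (x := 0) (r := R)) fun n => by simpa using hR n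
  have hγc := fun i => continuous_gibbs (hgc i) (hγ i)
  have hγe := fun i => continuous_entropy_gibbs (hgc i) (hγ i)
  have hreg : IsRegular fun i => γ i V₀ := fun i =>
    ⟨_, hγ i V₀, integrable_log_gibbsDensity_mul (hgV i V₀)⟩
  have hval := tendsto_gridValue hLip hq hfcont hδ hδcont hδint (h := h ∘ φ) (fun n => hh _)
    (hh0.comp hφ.tendsto_atTop) (fun n => hstoch _) (htail.comp φ) (lam := lam)
    (π := fun n => π (φ n)) (π₀ := fun i => γ i V₀)
    (fun i => by
      simp only [hπγ]
      exact ((hγc i).tendsto V₀).comp hV₀)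
    (fun i => by
      simp only [hπγ]
      exact (((hγe i).tendsto V₀).comp hV₀).const_mul lam)
  -- The loop closes: `V₀` defines the limiting Gibbs control and is also its value, so that control
  -- maximizes the Hamiltonian built from its own value.
  have hfix : ∀ j, contValue q (avgRewardEnt f δ lam) (fun i => γ i V₀) j = V₀ j := fun j =>
    tendsto_nhds_unique (hval j).2 (tendsto_pi_nhds.1 hV₀ j)
  refine ⟨φ, fun i => γ i V₀, fun n i => gibbsDensity (potential f q lam i (V n)),
    fun i => gibbsDensity (potential f q lam i V₀), hφ,
    fun n i => ⟨hdens n i, continuous_gibbsDensity (hgV i _)⟩,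
    fun i => ⟨hγ i V₀, continuous_gibbsDensity (hgV i _)⟩,
    fun i u => ((continuous_gibbsDensity_apply (hgc i) u).tendsto V₀).comp hV₀, ?_⟩
  refine isContEquilibrium_of_forall_le (continuousOn_avgRewardEnt hLip hfcont hδcont lam)
    hreg (fun j => (hval j).1) fun π' hπ' i => ?_
  simp only [hfix]
  rw [avgRewardEnt_add_eq hLip hfcont hδ hlam.ne', avgRewardEnt_add_eq hLip hfcont hδ hlam.ne',
    (hγ i V₀).entropy_gibbs (hgV i V₀)]
  obtain ⟨ρ, hρ, hρi⟩ := hπ' i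
  exact mul_le_mul_of_nonneg_left (hρ.free_energy_le hρi (hgV i V₀)) hlam.le

end Main

end RelaxedMDP

end

open RelaxedMDP in
theorem mainTheorem5 (d ℓ : ℕ) (hℓ : 1 ≤ ℓ) (U : Set (EuclideanSpace ℝ (Fin ℓ)))
    (hUc : IsCompact U) (hUpos : 0 < volume U) (hUcone : UniformCone U)
    (q : U → Matrix (Fin d) (Fin d) ℝ) (hq : ∀ u, IsRateMatrix (q u))
    (f : ℝ → Fin d → U → ℝ) (δ : ℝ → ℝ) (hδ : IsDiscount δ)
    (hint : IntegrableReward f δ) (hLip : UniformLipschitz f q)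
    (hfcont : ∀ i u, ContinuousOn (fun t => f t i u) (Ici 0))
    (hδcont : ContinuousOn δ (Ici 0))
    (h : ℕ → ℝ) (hh : ∀ n, h n ∈ Ioc (0 : ℝ) 1) (hh0 : Tendsto h atTop (𝓝 0))
    (hstoch : ∀ n u i, 0 ≤ stepMatrix (h n) q u i i)
    (htail : UniformTails f h) :
    (∀ lam : ℝ, 0 < lam → ∀ π : ℕ → Control d U,
      (∀ n, IsDiscEquilibrium {π | IsRegular π} (stepMatrix (h n) q)
        (avgRewardEnt (stepReward (h n) f) (stepDiscount (h n) δ) (h n * lam)) (π n)) →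
      ∃ (φ : ℕ → ℕ) (πlim : Control d U) (ρ : ℕ → Fin d → U → ℝ) (ρlim : Fin d → U → ℝ),
        StrictMono φ ∧
        (∀ n i, IsDensityOf (π n i) (ρ n i) ∧ Continuous (ρ n i)) ∧
        (∀ i, IsDensityOf (πlim i) (ρlim i) ∧ Continuous (ρlim i)) ∧
        (∀ i u, Tendsto (fun n => ρ (φ n) i u) atTop (𝓝 (ρlim i u))) ∧
        IsContEquilibrium {π | IsRegular π} q (avgRewardEnt f δ lam) πlim) ∧
    (∀ π : ℕ → Control d U,
      (∀ n, IsDiscEquilibrium univ (stepMatrix (h n) q) (avgReward (stepReward (h n) f)) (π n)) →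
      ∃ (φ : ℕ → ℕ) (πlim : Control d U),
        StrictMono φ ∧
        (∀ i, Tendsto (fun n => π (φ n) i) atTop (𝓝 (πlim i))) ∧
        IsContEquilibrium univ q (avgReward f) πlim) := by
  have : CompactSpace U := isCompact_iff_compactSpace.1 hUc
  have := isFiniteMeasure_leb hUc
  have := neZero_leb hUc hUpos
  exact ⟨fun lam hlam π hπ => tendsto_regularized_equilibria hUc hUcone hq hδ hint hLip hfcont
      hδcont hh hh0 hstoch htail hlam hπ,
    fun π hπ => tendsto_equilibria hq hδ hint hLip hfcont hδcont hh hh0 hstoch htail hπ⟩
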